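/- **Setting.** Let $n\ge 1$, let $\mathbb F$ be a field and let $V=\bigoplus_{i\in\mathbb Z/n}V_i$ be a finite-dimensional $\mathbb F$-vector space with a fixed decomposition (some $V_i$ may be $0$). Put $\widetilde V=\bigcup_i V_i$, $K=\prod_i GL(V_i)\subset GL(V)$, let $\mathcal N$ be the set of nilpotent $x\in\operatorname{End}(V)$ with $xV_i\subset V_{i+1}$ for all $i\in\mathbb Z/n$, and let $\xi(V)\colon m\mapsto\dim V_m$. The group $K$ acts on $V\times\mathcal N$ by $g\cdot(v,x)=(gv,gxg^{-1})$, preserving $\widetilde V\times\mathcal N$; write $\mathcal O_{v,x}$ for the orbit of $(v,x)$, and regard $K\backslash(\widetilde V\times\mathcal N)$ as a subset of $K\backslash(V\times\mathcal N)$. A *colored partition* $(\lambda,\epsilon)$ consists of a weakly decreasing $\lambda\colon\mathbb Z_{>0}\to\mathbb Z_{\ge0}$ that takes the value $0$, and $\epsilon\colon\mathbb Z_{>0}\to\mathbb Z/n$ taking every value infinitely often; $l(\lambda)=\#\{i:\lambda_i>0\}$. Its *signature* is $m\mapsto\#\{(i,j): 1\le j\le\lambda_i,\ \epsilon_i+[\lambda_i-j]=m\}$.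 A *marked colored partition* $(\lambda,\epsilon,\mu)$ has in addition $\mu\colon\mathbb Z_{>0}\to\mathbb Z$ with $\mu_i\le\lambda_i$ for all $i$; put $\nu=\lambda-\mu$. It is a *generalized colored quasi-bipartition* if $\mu_i>-n$ for all $i$, and $\mu_j<\mu_i+n$ and $\nu_j<\nu_i+n$ for all $i<j$ with $\epsilon_i+[\nu_i]=\epsilon_j+[\nu_j]$. It is a *colored quasi-bipartition* if $\mu_i>-n$ for all $i$, $\mu_j<\mu_i+n$ and $\nu_j<\nu_i+n$ for all $i<j$, and $\epsilon_i+[\nu_i]=\epsilon_j+[\nu_j]$ for all $i,j$. For $m\in\mathbb Z/n$ put $\rho_m(\lambda,\epsilon,\mu)=(\lambda,\epsilon,\delta)$ with $\delta_i=\max\{k\in\mathbb Z: k\le\mu_i,\ \epsilon_i+[\lambda_i-k]=m\}$. Two marked colored partitions $(\lambda,\epsilon,\mu)$, $(\alpha,\beta,\gamma)$ are *row equivalent* if $(\alpha,\beta,\gamma)=(\lambda\circ\sigma,\epsilon\circ\sigma,\mu\circ\sigma)$ for a permutation $\sigma$ of $\mathbb Z_{>0}$. They are *equivalent* if for some $\sigma$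 one has $\alpha=\lambda\circ\sigma$, $\beta=\epsilon\circ\sigma$, and $\gamma_i=\mu_{\sigma(i)}$ whenever $\gamma_i>0$ or $\mu_{\sigma(i)}>0$. Let $\widetilde{\mathcal P}_f$ be the set of equivalence classes of marked colored partitions of signature $f$, and $\widetilde{\mathcal Q}_f\subset\widetilde{\mathcal P}_f$ the set of those classes that contain a colored quasi-bipartition. A *colored Jordan basis of type $(\lambda,\epsilon)$* for $x\in\mathcal N$ is a basis $\{v_{i,j}: 1\le i\le l(\lambda),\ 1\le j\le\lambda_i\}$ of $V$ with $v_{i,j}\in V_{\epsilon_i+[\lambda_i-j]}$, $xv_{i,1}=0$ and $xv_{i,j}=v_{i,j-1}$ for $j>1$; we then say that $x$ has colored Jordan type $(\lambda,\epsilon)$, and put $v_{i,j}=0$ for $j\le0$. For $(\lambda,\epsilon,\mu)$ of signature $\xi(V)$ set $\Psi(\lambda,\epsilon,\mu)=\mathcal O_{v,x}$ with $v=\sum_{i=1}^{l(\lambda)}v_{i,\mu_i}$, where $x\in\mathcal N$ has a colored Jordan basis $\{v_{i,j}\}$ of type $(\lambda,\epsilon)$; this is independent of the choices and depends only on the class in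 $\widetilde{\mathcal P}_{\xi(V)}$. A *normal basis* for $(v,x)\in V\times\mathcal N$ is a colored Jordan basis $\{v_{i,j}\}$ for $x$, of type $(\lambda,\epsilon)$ say, such that $v=\sum_i v_{i,\mu_i}$ for a marking $\mu$ for which $(\lambda,\epsilon,\mu)$ is a generalized colored quasi-bipartition. **Theorem.** 1. The image of $\Psi$ in $K\backslash(V\times\mathcal N)$ is precisely the set of orbits whose elements admit a normal basis. Every nonempty fiber of $\Psi$ contains a generalized colored quasi-bipartition. 2. $\Psi$ restricts to a bijection $\widetilde{\mathcal Q}_{\xi(V)}\to K\backslash(\widetilde V\times\mathcal N)$. More precisely: - (a) an orbit $\mathcal O\in K\backslash(V\times\mathcal N)$ lies in $K\backslash(\widetilde V\times\mathcal N)$ if and only if $\mathcal O=\Psi(\lambda,\epsilon,\mu)$ for some colored quasi-bipartition $(\lambda,\epsilon,\mu)$ of signature $\xi(V)$; - (b) if $(v,x)\in\widetilde V\times\mathcal N$ and $v\ne0$, then any two colored quasi-bipartitions that $\Psi$ sends to $\mathcal O_{v,x}$ are row equivalent; - (c) if $x\in\mathcal N$, then the colored quasi-bipartitions that $\Psi$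 sends to $\mathcal O_{0,x}$ are precisely the $\rho_m(\lambda,\epsilon,0)$, where $m\in\mathbb Z/n$ and $(\lambda,\epsilon)$ is a colored Jordan type of $x$; for a fixed colored Jordan type $(\lambda,\epsilon)$ of $x$ they are, up to row equivalence, the $\rho_m(\lambda,\epsilon,0)$ with $m\in\mathbb Z/n$. -/

import Mathlib

namespace EnhancedCone

/-! ### Colored partitions and their markings

Rows are indexed from `0`, so that row `i` here is row `i + 1` in one-based notation. -/

/-- An `n`-colored partition `(λ, ε)`: `len` is `λ`, `color` is `ε`. -/
@[ext]
structure ColoredPartition (n : ℕ) where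
  len : ℕ → ℕ
  color : ℕ → ZMod n
  len_antitone : Antitone len
  exists_len_eq_zero : ∃ i, len i = 0
  infinite_color : ∀ m : ZMod n, {i | color i = m}.Infinite

/-- A marked colored partition `(λ, ε, μ)`: `mark` is `μ`. -/
@[ext]
structure MarkedColoredPartition (n : ℕ) extends ColoredPartition n where
  mark : ℕ → ℤ
  mark_le : ∀ i, mark i ≤ len i

namespace ColoredPartition

variable {n : ℕ} (c : ColoredPartition n)

/-- The number of nonzero rows. -/
noncomputable def length : ℕ := {i | 0 < c.len i}.ncard

/-- The boxes of the Young diagram: `⟨i, j⟩` is the box of row `i` and column `j`, columns being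
counted from `0` on the left. -/
abbrev Box : Type := Σ i : ℕ, Fin (c.len i)

/-- The rightmost box of row `i` has color `ε_i`, and colors increase by `1` from right to left.
(The one-based column of `p` is `p.2 + 1`.) -/
def boxColor (p : c.Box) : ZMod n :=
  c.color p.1 + ((((c.len p.1 : ℤ) - ((p.2 : ℕ) + 1 : ℤ)) : ℤ) : ZMod n)

/-- The number of boxes of each color. -/
noncomputable def signature (m : ZMod n) : ℕ := Nat.card {p : c.Box // c.boxColor p = m}

/-- The marking `μ = 0`. -/
def zeroMarking : MarkedColoredPartition n where
  toColoredPartition := c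
  mark := fun _ => 0
  mark_le := fun _ => Int.natCast_nonneg _

end ColoredPartition

namespace MarkedColoredPartition

variable {n : ℕ}

/-- `ν = λ - μ`. -/
def nu (P : MarkedColoredPartition n) (i : ℕ) : ℤ := (P.len i : ℤ) - P.mark i

/-- `ε_i + [ν_i]`. -/
def markColor (P : MarkedColoredPartition n) (i : ℕ) : ZMod n :=
  P.color i + ((P.nu i : ℤ) : ZMod n)

/-- Colored (`n`-)quasi-bipartitions. -/
def IsColoredQuasiBipartition (P : MarkedColoredPartition n) : Prop :=
  (∀ i, -(n : ℤ) < P.mark i) ∧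
  (∀ i j, i < j → P.mark j < P.mark i + n ∧ P.nu j < P.nu i + n) ∧
  (∀ i j, P.markColor i = P.markColor j)

/-- Generalized colored (`n`-)quasi-bipartitions: the inequalities are only required between
rows with `ε_i + [ν_i] = ε_j + [ν_j]`. -/
def IsGeneralizedQuasiBipartition (P : MarkedColoredPartition n) : Prop :=
  (∀ i, -(n : ℤ) < P.mark i) ∧
  (∀ i j, i < j → P.markColor i = P.markColor j →
    P.mark j < P.mark i + n ∧ P.nu j < P.nu i + n)

/-- Equality up to a permutation of the rows, along with the corresponding marks. -/
def RowEquiv (P Q : MarkedColoredPartition n) : Prop :=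
  ∃ σ : Equiv.Perm ℕ, ∀ i,
    Q.len i = P.len (σ i) ∧ Q.color i = P.color (σ i) ∧ Q.mark i = P.mark (σ i)

/-- Equality up to a permutation of the rows, where the values of nonpositive marks are
disregarded. -/
def WeakEquiv (P Q : MarkedColoredPartition n) : Prop :=
  ∃ σ : Equiv.Perm ℕ, ∀ i,
    Q.len i = P.len (σ i) ∧ Q.color i = P.color (σ i) ∧
    (0 < Q.mark i ∨ 0 < P.mark (σ i) → Q.mark i = P.mark (σ i))

theorem weakEquiv_equivalence : Equivalence (WeakEquiv (n := n)) where
  refl P := ⟨1, fun i => ⟨rfl, rfl, fun _ => rfl⟩⟩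
  symm := by
    rintro P Q ⟨σ, h⟩
    refine ⟨σ.symm, fun i => ?_⟩
    have := h (σ.symm i)
    rw [Equiv.apply_symm_apply] at this
    exact ⟨this.1.symm, this.2.1.symm, fun h' => (this.2.2 h'.symm).symm⟩
  trans := by
    rintro P Q R ⟨σ, h⟩ ⟨τ, k⟩
    refine ⟨σ * τ, fun i => ?_⟩
    obtain ⟨a, b, e⟩ := k i
    obtain ⟨a', b', e'⟩ := h (τ i)
    refine ⟨a.trans a', b.trans b', fun h' => ?_⟩
    simp only [Equiv.Perm.mul_apply] at h' ⊢
    omega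

/-- The possible values of a mark in row `i` that do not exceed `μ_i` and give color `m`. -/
def rhoCandidates (m : ZMod n) (P : MarkedColoredPartition n) (i : ℕ) : Set ℤ :=
  {k | k ≤ P.mark i ∧ P.color i + ((((P.len i : ℤ) - k : ℤ)) : ZMod n) = m}

theorem rhoCandidates_nonempty [NeZero n] (m : ZMod n) (P : MarkedColoredPartition n) (i : ℕ) :
    (rhoCandidates m P i).Nonempty := by
  refine ⟨P.mark i - ((m - P.markColor i).val : ℤ), by omega, ?_⟩
  simp only [markColor, nu]
  push_cast [ZMod.natCast_val, ZMod.cast_id]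
  ring

/-- `ρ_m(λ, ε, μ) = (λ, ε, δ)` with `δ_i = max {k ∈ ℤ | k ≤ μ_i, ε_i + [λ_i - k] = m}`. -/
noncomputable def rho [NeZero n] (m : ZMod n) (P : MarkedColoredPartition n) :
    MarkedColoredPartition n where
  toColoredPartition := P.toColoredPartition
  mark := fun i => sSup (rhoCandidates m P i)
  mark_le := fun i =>
    (csSup_le (rhoCandidates_nonempty m P i) fun _ hk => hk.1).trans (P.mark_le i)

end MarkedColoredPartition

/-- Marked colored partitions of signature `f`. -/
abbrev MarkedOfSignature {n : ℕ} (f : ZMod n → ℕ) : Type :=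
  {P : MarkedColoredPartition n // P.signature = f}

/-- The relation `WeakEquiv` on the marked colored partitions of signature `f`. -/
instance markedSetoid {n : ℕ} (f : ZMod n → ℕ) : Setoid (MarkedOfSignature f) :=
  Setoid.comap Subtype.val ⟨MarkedColoredPartition.WeakEquiv,
    MarkedColoredPartition.weakEquiv_equivalence⟩

/-- Classes of marked colored partitions of signature `f` under `WeakEquiv`. -/
abbrev MarkedClass {n : ℕ} (f : ZMod n → ℕ) : Type := Quotient (markedSetoid f)

/-- The classes that contain at least one colored quasi-bipartition. -/
def quasiBipartitionClasses {n : ℕ} (f : ZMod n → ℕ) : Set (MarkedClass f) :=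
  {q | ∃ P : MarkedOfSignature f, P.1.IsColoredQuasiBipartition ∧ ⟦P⟧ = q}

/-! ### The enhanced colored nilpotent cone -/

section Cone

variable {F : Type*} [Field F] {V : Type*} [AddCommGroup V] [Module F V] {n : ℕ}

/-- The signature `ξ(V)` of the colored vector space `V = ⨁ V_i`, where `V_i = C i`. -/
noncomputable def spaceSignature (C : ZMod n → Submodule F V) (m : ZMod n) : ℕ :=
  Module.finrank F (C m)

/-- The set of colored vectors, the union of the `V_i`. -/
def coloredVectors (C : ZMod n → Submodule F V) : Set V := ⋃ i, (C i : Set V)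

/-- The group `K` of linear automorphisms of `V` that preserve every `V_i`. -/
def colorGroup (C : ZMod n → Submodule F V) : Subgroup (V ≃ₗ[F] V) where
  carrier := {g | ∀ i v, g v ∈ C i ↔ v ∈ C i}
  one_mem' := fun _ _ => Iff.rfl
  mul_mem' := fun {a b} ha hb i v => (ha i (b v)).trans (hb i v)
  inv_mem' := fun {a} ha i v => by
    have h := ha i (a⁻¹ v)
    rw [show a (a⁻¹ v) = v from a.apply_symm_apply v] at h
    exact h.symm

/-- The colored nilpotent cone: nilpotent `x ∈ End(V)` with `x V_i ⊆ V_{i+1}`. -/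
def NilCone (C : ZMod n → Submodule F V) : Type _ :=
  {x : Module.End F V // IsNilpotent x ∧ ∀ i, ∀ v ∈ C i, x v ∈ C (i + 1)}

/-- `K` acts on the colored nilpotent cone by conjugation. -/
instance (C : ZMod n → Submodule F V) : MulAction (colorGroup C) (NilCone C) where
  smul g x := ⟨(g : V ≃ₗ[F] V).conj x.1,
    by
      obtain ⟨⟨k, hk⟩, -⟩ := x.2
      refine ⟨⟨k, ?_⟩, fun i v hv => ?_⟩
      · have := (map_pow ((g : V ≃ₗ[F] V).conjRingEquiv) x.1 k).symm
        rw [hk, map_zero] at this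
        exact this
      · have h1 : (g : V ≃ₗ[F] V).symm v ∈ C i := ((g⁻¹).2 i v).2 hv
        exact (g.2 _ _).2 (x.2.2 i _ h1)⟩
  one_smul x := Subtype.ext (LinearMap.ext fun _ => rfl)
  mul_smul g h x := Subtype.ext (LinearMap.ext fun _ => rfl)

/-- The set `K \ (V × 𝒩)` of orbits of the diagonal action. -/
abbrev Orbit (C : ZMod n → Submodule F V) : Type _ :=
  MulAction.orbitRel.Quotient (colorGroup C) (V × NilCone C)

/-- The orbit of `(v, x)`. -/
def orbitOf (C : ZMod n → Submodule F V) (v : V) (x : NilCone C) : Orbit C :=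
  Quotient.mk _ (v, x)

/-- The subset of `K \ (V × 𝒩)` consisting of the orbits contained in `(⋃ V_i) × 𝒩`. -/
def enhancedOrbits (C : ZMod n → Submodule F V) : Set (Orbit C) :=
  {O | ∃ v ∈ coloredVectors C, ∃ x, orbitOf C v x = O}

/-- The basis `b`, labeled by the boxes of the diagram of `c = (λ, ε)`, is a colored Jordan basis
for `x` of type `(λ, ε)`. -/
structure IsColoredJordanBasis (C : ZMod n → Submodule F V) (x : Module.End F V)
    (c : ColoredPartition n) (b : Module.Basis c.Box F V) : Prop where
  mem_color : ∀ p, b p ∈ C (c.boxColor p)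
  apply_first : ∀ i (h : 0 < c.len i), x (b ⟨i, ⟨0, h⟩⟩) = 0
  apply_succ : ∀ i j (h : j + 1 < c.len i),
    x (b ⟨i, ⟨j + 1, h⟩⟩) = b ⟨i, ⟨j, (Nat.lt_succ_self j).trans h⟩⟩

/-- `(λ, ε)` is a colored Jordan type of `x`. -/
def HasColoredJordanType (C : ZMod n → Submodule F V) (x : Module.End F V)
    (c : ColoredPartition n) : Prop :=
  ∃ b : Module.Basis c.Box F V, IsColoredJordanBasis C x c b

/-- The vector `v_{i,k}` (with one-based column `k`), extended by `v_{i,k} = 0` for `k ≤ 0`. -/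
noncomputable def basisVector (c : ColoredPartition n) (b : Module.Basis c.Box F V)
    (i : ℕ) (k : ℤ) : V :=
  if h : 0 < k ∧ k ≤ c.len i then b ⟨i, ⟨(k - 1).toNat, by omega⟩⟩ else 0

/-- The vector `∑ v_{i, μ_i}`, the sum being over the nonzero rows. -/
noncomputable def markedVector (P : MarkedColoredPartition n)
    (b : Module.Basis P.Box F V) : V :=
  ∑ i ∈ Finset.range P.length, basisVector P.toColoredPartition b i (P.mark i)

/-- `(v, x)` admits a normal basis. -/
def HasNormalBasis (C : ZMod n → Submodule F V) (v : V) (x : NilCone C) : Prop :=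
  ∃ (P : MarkedColoredPartition n) (b : Module.Basis P.Box F V),
    IsColoredJordanBasis C x.1 P.toColoredPartition b ∧
    v = markedVector P b ∧ P.IsGeneralizedQuasiBipartition

/-! ### Existence and independence of choices, needed to define `Ψ` -/

theorem ColoredPartition.exists_lt_iff (c : ColoredPartition n) :
    ∃ N, ∀ i, 0 < c.len i ↔ i < N := by
  classical
  refine ⟨Nat.find c.exists_len_eq_zero, fun i => ?_⟩
  rw [Nat.lt_find_iff]
  constructor
  · intro h m hm h0
    have := c.len_antitone hm
    omega
  · intro h
    exact Nat.pos_of_ne_zero (h i le_rfl)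

theorem ColoredPartition.len_pos_iff (c : ColoredPartition n) (i : ℕ) :
    0 < c.len i ↔ i < c.length := by
  obtain ⟨N, hN⟩ := c.exists_lt_iff
  have : {i | 0 < c.len i} = (Finset.range N : Set ℕ) := by
    ext i; simp [hN]
  rw [ColoredPartition.length, this, Set.ncard_coe_finset, Finset.card_range, hN]

instance ColoredPartition.finite_box (c : ColoredPartition n) : Finite c.Box := by
  refine Finite.of_injective
    (β := Σ i : Fin c.length, Fin (c.len i))
    (fun p => ⟨⟨p.1, (c.len_pos_iff p.1).1 (Fin.pos p.2)⟩, p.2⟩) ?_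
  rintro ⟨i, j⟩ ⟨i', j'⟩ h
  simp only [Sigma.mk.injEq, Fin.mk.injEq] at h
  obtain ⟨rfl, h⟩ := h
  simpa using h

theorem markedVector_eq_finsum (P : MarkedColoredPartition n) (b : Module.Basis P.Box F V) :
    markedVector P b = ∑ᶠ i, basisVector P.toColoredPartition b i (P.mark i) := by
  refine (finsum_eq_sum_of_support_subset _ fun i hi => ?_).symm
  simp only [Finset.coe_range, Set.mem_Iio, ← P.len_pos_iff]
  by_contra h
  refine hi (dif_neg ?_)
  have := P.mark_le i
  omega

/-- A linear map is controlled on each `V_m` by its values on the basis vectors of color `m`. -/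
theorem map_mem_of_colored {C D : ZMod n → Submodule F V} (hC : DirectSum.IsInternal C)
    {c : ColoredPartition n} (b : Module.Basis c.Box F V) (hb : ∀ p, b p ∈ C (c.boxColor p))
    (f : V →ₗ[F] V) (hf : ∀ p, f (b p) ∈ D (c.boxColor p)) (m : ZMod n) (v : V)
    (hv : v ∈ C m) : f v ∈ D m := by
  classical
  let S : ZMod n → Submodule F V := fun k => Submodule.span F (b '' {p | c.boxColor p = k})
  have hSC : ∀ k, S k ≤ C k := fun k => Submodule.span_le.2 (by
    rintro _ ⟨p, rfl, rfl⟩; exact hb p)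
  have hSD : ∀ k, S k ≤ (D k).comap f := fun k => Submodule.span_le.2 (by
    rintro _ ⟨p, rfl, rfl⟩; exact hf p)
  have htop : S m ⊔ ⨆ k, ⨆ _ : k ≠ m, S k = ⊤ := by
    rw [eq_top_iff, ← b.span_eq, Submodule.span_le]
    rintro _ ⟨p, rfl⟩
    have hp : b p ∈ S (c.boxColor p) := Submodule.subset_span ⟨p, rfl, rfl⟩
    by_cases h : c.boxColor p = m
    · exact Submodule.mem_sup_left (h ▸ hp)
    · exact Submodule.mem_sup_right
        ((le_iSup₂_of_le (f := fun k (_ : k ≠ m) => S k) _ h le_rfl) hp)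
  obtain ⟨a, ha, d, hd, rfl⟩ := Submodule.mem_sup.1 (htop ▸ Submodule.mem_top : v ∈ _)
  have hd' : d ∈ ⨆ k, ⨆ _ : k ≠ m, C k := (iSup₂_mono fun k _ => hSC k) hd
  have hdm : d ∈ C m := by
    have := (C m).sub_mem hv (hSC m ha)
    simpa using this
  have h0 : d = 0 :=
    Submodule.disjoint_def.1 (hC.submodule_iSupIndep m) d hdm hd'
  rw [h0, add_zero]
  exact hSD m ha

/-- Bases of any given type exist, as soon as the signatures agree. -/
theorem exists_colored_basis [FiniteDimensional F V] [NeZero n] {C : ZMod n → Submodule F V}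
    (hC : DirectSum.IsInternal C) {c : ColoredPartition n}
    (hc : c.signature = spaceSignature C) :
    ∃ b : Module.Basis c.Box F V, ∀ p, b p ∈ C (c.boxColor p) := by
  classical
  let e : ∀ m, {p : c.Box // c.boxColor p = m} ≃ Fin (Module.finrank F (C m)) := fun m =>
    (Finite.equivFin _).trans (finCongr (congrFun hc m))
  let B := hC.collectedBasis fun m => Module.finBasis F (C m)
  let E : c.Box ≃ Σ m, Fin (Module.finrank F (C m)) :=
    (Equiv.sigmaFiberEquiv c.boxColor).symm.trans (Equiv.sigmaCongrRight e)
  refine ⟨B.reindex E.symm, fun p => ?_⟩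
  rw [Module.Basis.reindex_apply]
  exact hC.collectedBasis_mem (fun m => Module.finBasis F (C m)) (E p)

/-- The endomorphism that moves every box to the box on its left. -/
noncomputable def shift (c : ColoredPartition n) (b : Module.Basis c.Box F V) : Module.End F V :=
  b.constr F fun p => basisVector c b p.1 (p.2 : ℕ)

theorem shift_isColoredJordanBasis {C : ZMod n → Submodule F V} {c : ColoredPartition n}
    {b : Module.Basis c.Box F V} (hb : ∀ p, b p ∈ C (c.boxColor p)) :
    IsColoredJordanBasis C (shift c b) c b where
  mem_color := hb
  apply_first i h := by simp [shift, basisVector]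
  apply_succ i j h := by
    rw [shift, Module.Basis.constr_basis, basisVector, dif_pos]
    · congr 3
      simp
    · constructor
      · simp only; omega
      · simp only; omega

theorem shift_mem {C : ZMod n → Submodule F V} (hC : DirectSum.IsInternal C)
    {c : ColoredPartition n} {b : Module.Basis c.Box F V}
    (hb : ∀ p, b p ∈ C (c.boxColor p)) :
    IsNilpotent (shift c b) ∧ ∀ i, ∀ v ∈ C i, shift c b v ∈ C (i + 1) := by
  have hJ := shift_isColoredJordanBasis hb
  constructor
  · have key : ∀ i j (h : j < c.len i), ((shift c b) ^ (j + 1)) (b ⟨i, ⟨j, h⟩⟩) = 0 := by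
      intro i j
      induction j with
      | zero => intro h; simpa using hJ.apply_first i h
      | succ j ih =>
        intro h
        rw [pow_succ, Module.End.mul_apply, hJ.apply_succ]
        exact ih _
    refine ⟨c.len 0, b.ext ?_⟩
    rintro ⟨i, j, h⟩
    have h0 : c.len i ≤ c.len 0 := c.len_antitone (Nat.zero_le i)
    have h1 : c.len 0 = (c.len 0 - (j + 1)) + (j + 1) := by omega
    rw [h1, pow_add, Module.End.mul_apply, key, map_zero, LinearMap.zero_apply]
  · refine map_mem_of_colored (D := fun i => C (i + 1)) hC b hb _ ?_
    rintro ⟨i, j, h⟩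
    cases j with
    | zero => rw [hJ.apply_first]; exact Submodule.zero_mem _
    | succ j =>
      rw [hJ.apply_succ]
      have : c.boxColor ⟨i, ⟨j + 1, h⟩⟩ + 1 =
          c.boxColor ⟨i, ⟨j, (Nat.lt_succ_self j).trans h⟩⟩ := by
        simp only [ColoredPartition.boxColor]; push_cast; ring
      rw [this]
      exact hb _

theorem exists_psi [FiniteDimensional F V] [NeZero n] {C : ZMod n → Submodule F V}
    (hC : DirectSum.IsInternal C) (P : MarkedOfSignature (spaceSignature C)) :
    ∃ O : Orbit C, ∃ (x : NilCone C) (b : Module.Basis P.1.Box F V),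
      IsColoredJordanBasis C x.1 P.1.toColoredPartition b ∧
      O = orbitOf C (markedVector P.1 b) x := by
  obtain ⟨b, hb⟩ := exists_colored_basis hC P.2
  exact ⟨_, ⟨shift _ b, shift_mem hC hb⟩, b, shift_isColoredJordanBasis hb, rfl⟩

/-- The orbit of `(∑ v_{i, μ_i}, x)` depends only on the class of `(λ, ε, μ)`. -/
theorem orbitOf_eq_of_weakEquiv {C : ZMod n → Submodule F V} (hC : DirectSum.IsInternal C)
    {P Q : MarkedColoredPartition n} (h : P.WeakEquiv Q) {x y : NilCone C}
    {b : Module.Basis P.Box F V} {d : Module.Basis Q.Box F V}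
    (hb : IsColoredJordanBasis C x.1 P.toColoredPartition b)
    (hd : IsColoredJordanBasis C y.1 Q.toColoredPartition d) :
    orbitOf C (markedVector P b) x = orbitOf C (markedVector Q d) y := by
  obtain ⟨σ, hσ⟩ := h
  let e : Q.Box ≃ P.Box := Equiv.sigmaCongr σ fun i => finCongr (hσ i).1
  let g : V ≃ₗ[F] V := b.equiv d e.symm
  have hgd : ∀ p, g (b (e p)) = d p := fun p => by simp [g]
  have hgb : ∀ i j (h : j < Q.len i),
      g (b ⟨σ i, ⟨j, (hσ i).1 ▸ h⟩⟩) = d ⟨i, ⟨j, h⟩⟩ := fun i j h => hgd ⟨i, ⟨j, h⟩⟩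
  have hcol : ∀ p, P.boxColor (e p) = Q.boxColor p := by
    rintro ⟨i, j, h⟩
    change P.boxColor ⟨σ i, ⟨j, _⟩⟩ = _
    simp only [ColoredPartition.boxColor, hσ i]
  have hg1 : ∀ m v, v ∈ C m → g v ∈ C m := by
    refine map_mem_of_colored (D := C) hC b hb.mem_color g.toLinearMap fun p => ?_
    obtain ⟨p, rfl⟩ := e.surjective p
    change g _ ∈ _
    rw [hgd, hcol]
    exact hd.mem_color p
  have hg2 : ∀ m v, v ∈ C m → g.symm v ∈ C m := by
    refine map_mem_of_colored (D := C) hC d hd.mem_color g.symm.toLinearMap fun p => ?_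
    change g.symm _ ∈ _
    rw [← hgd, LinearEquiv.symm_apply_apply, ← hcol]
    exact hb.mem_color _
  have hgK : g ∈ colorGroup C := fun m v =>
    ⟨fun h => by simpa using hg2 m _ h, hg1 m v⟩
  have hx : ∀ v, g (x.1 v) = y.1 (g v) := by
    have : g.toLinearMap ∘ₗ x.1 = y.1 ∘ₗ g.toLinearMap := by
      refine (b.reindex e.symm).ext ?_
      rintro ⟨i, j, h⟩
      simp only [Module.Basis.reindex_apply, Equiv.symm_symm, LinearMap.comp_apply,
        LinearEquiv.coe_coe, hgd]
      change g (x.1 (b ⟨σ i, ⟨j, (hσ i).1 ▸ h⟩⟩)) = _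
      cases j with
      | zero => rw [hb.apply_first, hd.apply_first, map_zero]
      | succ j => rw [hb.apply_succ, hd.apply_succ, hgb]
    exact fun v => LinearMap.congr_fun this v
  have hv : g (markedVector P b) = markedVector Q d := by
    rw [markedVector_eq_finsum, markedVector_eq_finsum, ← finsum_comp_equiv σ]
    have hfin : (Function.support fun i =>
        basisVector P.toColoredPartition b (σ i) (P.mark (σ i))).Finite := by
      refine ((Finset.range P.length).finite_toSet.preimage σ.injective.injOn).subset ?_
      intro i hi
      simp only [Set.mem_preimage, Finset.coe_range, Set.mem_Iio, ← P.len_pos_iff]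
      by_contra h
      refine hi (dif_neg ?_)
      omega
    have := map_finsum (g : V ≃ₗ[F] V).toLinearMap.toAddMonoidHom hfin
    refine this.trans (finsum_congr fun i => ?_)
    change g _ = _
    obtain ⟨h1, -, h3⟩ := hσ i
    have hQ := Q.mark_le i
    by_cases hpos : 0 < Q.mark i
    · have h4 := h3 (Or.inl hpos)
      rw [basisVector, basisVector, dif_pos ⟨h4 ▸ hpos, P.mark_le _⟩, dif_pos ⟨hpos, hQ⟩,
        ← hgb]
      congr 4
      rw [h4]
    · have h4 : ¬ 0 < P.mark (σ i) := fun h => hpos (by rw [h3 (Or.inr h)]; exact h)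
      rw [basisVector, basisVector, dif_neg (by tauto), dif_neg (by tauto), map_zero]
  refine (Quotient.sound ?_).symm
  refine ⟨⟨g, hgK⟩, Prod.ext hv (Subtype.ext (LinearMap.ext fun v => ?_))⟩
  change g (x.1 (g.symm v)) = y.1 v
  rw [hx, LinearEquiv.apply_symm_apply]

/-! ### The map `Ψ` -/

/-- `Ψ(λ, ε, μ)` is the orbit of `(∑ v_{i, μ_i}, x)`, where `{v_{i,j}}` is a colored Jordan basis
of type `(λ, ε)` for `x`. -/
noncomputable def psi [FiniteDimensional F V] [NeZero n] (C : ZMod n → Submodule F V)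
    (hC : DirectSum.IsInternal C) (P : MarkedOfSignature (spaceSignature C)) : Orbit C :=
  (exists_psi hC P).choose

theorem psi_eq [FiniteDimensional F V] [NeZero n] {C : ZMod n → Submodule F V}
    (hC : DirectSum.IsInternal C) (P : MarkedOfSignature (spaceSignature C)) {x : NilCone C}
    {b : Module.Basis P.1.Box F V} (hb : IsColoredJordanBasis C x.1 P.1.toColoredPartition b) :
    psi C hC P = orbitOf C (markedVector P.1 b) x := by
  obtain ⟨y, d, hd, h⟩ := (exists_psi hC P).choose_spec
  exact h.trans (orbitOf_eq_of_weakEquiv hC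
    (MarkedColoredPartition.weakEquiv_equivalence.refl P.1) hd hb)

/-- `Ψ` as a map on classes of marked colored partitions of signature `ξ(V)`. -/
noncomputable def psiClass [FiniteDimensional F V] [NeZero n] (C : ZMod n → Submodule F V)
    (hC : DirectSum.IsInternal C) : MarkedClass (spaceSignature C) → Orbit C :=
  Quotient.lift (psi C hC) fun P Q h => by
    obtain ⟨x, b, hb, hP⟩ := (exists_psi hC P).choose_spec
    obtain ⟨y, d, hd, hQ⟩ := (exists_psi hC Q).choose_spec
    exact hP.trans ((orbitOf_eq_of_weakEquiv hC h hb hd).trans hQ.symm)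

/-- The marked colored partition `P` has signature `ξ(V)` and `Ψ` sends it to `O`. -/
def CorrespondsTo [FiniteDimensional F V] [NeZero n] (C : ZMod n → Submodule F V)
    (hC : DirectSum.IsInternal C) (P : MarkedColoredPartition n) (O : Orbit C) : Prop :=
  ∃ h : P.signature = spaceSignature C, psi C hC ⟨P, h⟩ = O

end Cone

end EnhancedCone

open EnhancedCone

/-! A colored Jordan basis splits `V` into graded cyclic `F[x]`-modules: row `i` is generated by its
last vector `v_{i,λ_i}`, with annihilator `x ^ λ_i`. Hence a color-preserving endomorphism commuting
with `x` amounts to a choice of images of these generators, constrained only by color and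
annihilation (`IsColoredJordanBasis.exists_end`). An injective one moves `v` within its orbit for
fixed `x` (`orbitOf_apply_eq`). Both the normal forms and their uniqueness come from well-chosen
endomorphisms of this kind.

Existence: a colored Jordan basis is found by shortening a generating family until it is independent
(`exists_hasColoredJordanType`). If `v` is colored, its part in one row only meets columns in a
single class modulo `n`, so it is a power of `x` applied to another generator of that row; changing
all generators at once turns `v` into `∑ v_{i,μ_i}` (`exists_rowSum_of_mem`). If two rows of equal
mark color violate a quasi-bipartition inequality, a unipotent endomorphism raises one of the marks
by `n` (`orbitOf_rowSum_update`). As `∑ ν_i` drops, this stops at a generalized quasi-bipartition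
(`exists_generalized`), which gives part 1. Mark colors do not change on the way, so for colored `v`
the result is a colored quasi-bipartition.

Uniqueness: the numbers of rows of each length and color are read off from the dimensions of
`socle`. To compare marks, one row of the first basis is mapped onto the matching row of the second
and all others to zero; the columns that the image of `v` can reach bound the first mark by the
second plus `n`, strictly, and congruence modulo `n` removes the slack
(`mark_le_of_markedVector_eq`). For `v = 0` only marks in `(-n, 0]` are possible, and such marks are
fixed by their color; this leaves the `ρ_m`. -/

namespace EnhancedCone

/-! ### Coordinates in a colored Jordan basis, with integer columns -/

section Coordinates

variable {F : Type*} [Field F] {V : Type*} [AddCommGroup V] [Module F V] {n : ℕ}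
  {C : ZMod n → Submodule F V} {c : ColoredPartition n} {b : Module.Basis c.Box F V}
  {x : Module.End F V}

theorem basisVector_of_nonpos {i : ℕ} {k : ℤ} (h : k ≤ 0) : basisVector c b i k = 0 :=
  dif_neg (by omega)

theorem basisVector_add_one (i j : ℕ) (h : j < c.len i) :
    basisVector c b i (j + 1) = b ⟨i, ⟨j, h⟩⟩ := by
  rw [basisVector, dif_pos ⟨by omega, by omega⟩]
  congr 3
  simp

theorem exists_box_of_pos {i : ℕ} {k : ℤ} (h0 : 0 < k) (hk : k ≤ c.len i) :
    ∃ j : ℕ, j < c.len i ∧ k = j + 1 :=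
  ⟨(k - 1).toNat, by omega, by omega⟩

theorem linearMap_ext_basisVector {W : Type*} [AddCommGroup W] [Module F W] {f g : V →ₗ[F] W}
    (b : Module.Basis c.Box F V)
    (h : ∀ i (k : ℤ), 0 < k → k ≤ c.len i → f (basisVector c b i k) = g (basisVector c b i k)) :
    f = g := by
  refine b.ext ?_
  rintro ⟨i, j, hj⟩
  have := h i (j + 1) (by omega) (by omega)
  rwa [basisVector_add_one i j hj] at this

namespace IsColoredJordanBasis

theorem basisVector_mem (hb : IsColoredJordanBasis C x c b) (i : ℕ) (k : ℤ) :
    basisVector c b i k ∈ C (c.color i + (((c.len i : ℤ) - k : ℤ) : ZMod n)) := by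
  by_cases h : 0 < k ∧ k ≤ c.len i
  · obtain ⟨j, hj, rfl⟩ := exists_box_of_pos h.1 h.2
    rw [basisVector_add_one i j hj]
    exact hb.mem_color ⟨i, ⟨j, hj⟩⟩
  · rw [basisVector, dif_neg h]
    exact Submodule.zero_mem _

theorem apply_basisVector (hb : IsColoredJordanBasis C x c b) {i : ℕ} {k : ℤ}
    (hk : k ≤ c.len i) : x (basisVector c b i k) = basisVector c b i (k - 1) := by
  by_cases h : 0 < k
  · obtain ⟨j, hj, rfl⟩ := exists_box_of_pos h hk
    rw [basisVector_add_one i j hj, add_sub_cancel_right]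
    cases j with
    | zero => rw [hb.apply_first, basisVector_of_nonpos (by simp)]
    | succ j =>
      rw [hb.apply_succ]
      push_cast
      rw [basisVector_add_one i j (by omega)]
  · rw [basisVector_of_nonpos (by omega), basisVector_of_nonpos (by omega), map_zero]

theorem pow_apply_basisVector (hb : IsColoredJordanBasis C x c b) {i : ℕ} {k : ℤ}
    (hk : k ≤ c.len i) (s : ℕ) :
    (x ^ s) (basisVector c b i k) = basisVector c b i (k - s) := by
  induction s with
  | zero => simp
  | succ s ih =>
    rw [pow_succ', Module.End.mul_apply, ih, hb.apply_basisVector (by omega)]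
    congr 1
    push_cast
    ring

end IsColoredJordanBasis

/-- The coefficient of `v_{i,k}` (with one-based column `k`), which is zero if there is no such
box. -/
noncomputable def coordAt (c : ColoredPartition n) (b : Module.Basis c.Box F V) (i : ℕ) (k : ℤ) :
    V →ₗ[F] F :=
  if h : 0 < k ∧ k ≤ c.len i then b.coord ⟨i, ⟨(k - 1).toNat, by omega⟩⟩ else 0

theorem coordAt_eq_zero {i : ℕ} {k : ℤ} (h : ¬ (0 < k ∧ k ≤ c.len i)) : coordAt c b i k = 0 :=
  dif_neg h

theorem coordAt_add_one (i j : ℕ) (h : j < c.len i) :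
    coordAt c b i (j + 1) = b.coord ⟨i, ⟨j, h⟩⟩ := by
  rw [coordAt, dif_pos ⟨by omega, by omega⟩]
  congr 3
  simp

theorem coordAt_basisVector {i : ℕ} {k : ℤ} (h0 : 0 < k) (hk : k ≤ c.len i) (i' : ℕ) (k' : ℤ) :
    coordAt c b i' k' (basisVector c b i k) = if i' = i ∧ k' = k then 1 else 0 := by
  by_cases h : 0 < k' ∧ k' ≤ c.len i'
  · obtain ⟨j, hj, rfl⟩ := exists_box_of_pos h0 hk
    obtain ⟨j', hj', rfl⟩ := exists_box_of_pos h.1 h.2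
    rw [basisVector_add_one i j hj, coordAt_add_one i' j' hj', Module.Basis.coord_apply,
      Module.Basis.repr_self, Finsupp.single_apply]
    refine if_congr ?_ rfl rfl
    constructor
    · intro h
      simp only [Sigma.mk.injEq] at h
      obtain ⟨rfl, h⟩ := h
      simp at h
      simp [h]
    · rintro ⟨rfl, h⟩
      have : j' = j := by omega
      subst this
      rfl
  · rw [coordAt_eq_zero h, if_neg, LinearMap.zero_apply]
    rintro ⟨rfl, rfl⟩
    exact h ⟨h0, hk⟩

theorem eq_zero_of_coordAt {u : V} (h : ∀ i (k : ℤ), 0 < k → k ≤ c.len i → coordAt c b i k u = 0) :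
    u = 0 := by
  refine b.ext_elem ?_
  rintro ⟨i, j, hj⟩
  have := h i (j + 1) (by omega) (by omega)
  rw [coordAt_add_one i j hj] at this
  simpa using this

namespace IsColoredJordanBasis

/-- Positivity of `k` matters: at `k = 0` the left side vanishes by convention, while the right side
is the coefficient of `v_{i,1}`. -/
theorem coordAt_apply (hb : IsColoredJordanBasis C x c b) {i : ℕ} {k : ℤ} (h0 : 0 < k) (u : V) :
    coordAt c b i k (x u) = coordAt c b i (k + 1) u := by
  have : coordAt c b i k ∘ₗ x = coordAt c b i (k + 1) := by
    refine linearMap_ext_basisVector b fun i' k' h0' hk' => ?_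
    rw [LinearMap.comp_apply, hb.apply_basisVector hk', coordAt_basisVector h0' hk']
    by_cases h1 : 0 < k' - 1
    · rw [coordAt_basisVector h1 (by omega)]
      refine if_congr (and_congr_right fun _ => ?_) rfl rfl
      omega
    · rw [basisVector_of_nonpos (by omega), map_zero, if_neg (by omega)]
  exact LinearMap.congr_fun this u

theorem coordAt_pow_apply (hb : IsColoredJordanBasis C x c b) {i : ℕ} {k : ℤ} (h0 : 0 < k)
    (s : ℕ) (u : V) : coordAt c b i k ((x ^ s) u) = coordAt c b i (k + s) u := by
  induction s generalizing u with
  | zero => simp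
  | succ s ih =>
    rw [pow_succ, Module.End.mul_apply, ih, hb.coordAt_apply (by omega)]
    congr 2
    push_cast
    ring

theorem color_eq_of_coordAt_ne_zero (hC : DirectSum.IsInternal C)
    (hb : IsColoredJordanBasis C x c b) {m : ZMod n} {u : V} (hu : u ∈ C m) {i : ℕ} {k : ℤ}
    (h : coordAt c b i k u ≠ 0) :
    c.color i + (((c.len i : ℤ) - k : ℤ) : ZMod n) = m := by
  classical
  by_contra hm
  have hik : 0 < k ∧ k ≤ c.len i := by
    by_contra h'
    rw [coordAt_eq_zero h'] at h
    exact h rfl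
  -- The rank-one projection to the line of `v_{i,k}` preserves colors, so it kills every `C m`
  -- except the one containing `v_{i,k}`; `D` encodes this.
  have := map_mem_of_colored (D := fun m => if c.color i + (((c.len i : ℤ) - k : ℤ) : ZMod n) = m
    then ⊤ else ⊥) hC b hb.mem_color ((coordAt c b i k).smulRight (basisVector c b i k)) (by
      rintro ⟨i', j', hj'⟩
      split_ifs with h'
      · trivial
      · rw [← basisVector_add_one i' j' hj', LinearMap.smulRight_apply,
          coordAt_basisVector (by omega) (by omega), if_neg, zero_smul]
        · exact Submodule.zero_mem _
        · rintro ⟨rfl, rfl⟩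
          exact h' rfl) m u hu
  simp only [if_neg hm, LinearMap.smulRight_apply, Submodule.mem_bot] at this
  have h2 := congrArg (coordAt c b i k) this
  rw [map_smul, coordAt_basisVector hik.1 hik.2, map_zero] at h2
  simp at h2
  exact h h2

end IsColoredJordanBasis

theorem mem_span_image_box {S : Set c.Box} {u : V}
    (h : ∀ i j (hj : j < c.len i), coordAt c b i (j + 1) u ≠ 0 → (⟨i, ⟨j, hj⟩⟩ : c.Box) ∈ S) :
    u ∈ Submodule.span F (b '' S) := by
  rw [Module.Basis.mem_span_image]
  rintro ⟨i, j, hj⟩ hp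
  refine h i j hj ?_
  rw [coordAt_add_one i j hj]
  simpa using hp

theorem finrank_span_image_box (S : Set c.Box) :
    Module.finrank F (Submodule.span F (b '' S)) = Nat.card S := by
  classical
  have : Fintype S := Fintype.ofFinite _
  have h := finrank_span_eq_card (R := F) (b := fun p : S => b p)
    (b.linearIndependent.comp _ Subtype.val_injective)
  rw [Nat.card_eq_fintype_card, ← h, Set.image_eq_range]

/-- Each `C m` is spanned by the basis vectors of color `m`. It makes the signature condition in
`CorrespondsTo` automatic once a basis is at hand. -/
theorem IsColoredJordanBasis.signature_eq (hC : DirectSum.IsInternal C)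
    (hb : IsColoredJordanBasis C x c b) : c.signature = spaceSignature C := by
  funext m
  have : C m = Submodule.span F (b '' {p | c.boxColor p = m}) := by
    refine le_antisymm (fun u hu => mem_span_image_box fun i j hj h => ?_) ?_
    · exact hb.color_eq_of_coordAt_ne_zero hC hu h
    · rw [Submodule.span_le]
      rintro _ ⟨p, rfl, rfl⟩
      exact hb.mem_color p
  rw [spaceSignature, this, finrank_span_image_box]
  rfl

/-- The vectors of color `a` in `ker x ∩ im x ^ s`. -/
def socle (C : ZMod n → Submodule F V) (x : Module.End F V) (s : ℕ) (a : ZMod n) :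
    Submodule F V :=
  LinearMap.ker x ⊓ LinearMap.range (x ^ s) ⊓ C a

/-- The first box of a row spans its share of `ker x`, and lies in the image of `x ^ s` exactly when
the row has more than `s` boxes. The left side does not mention the basis, so these counts are
invariants of `x`. -/
theorem IsColoredJordanBasis.finrank_socle (hC : DirectSum.IsInternal C)
    (hb : IsColoredJordanBasis C x c b) (s : ℕ) (a : ZMod n) :
    Module.finrank F (socle C x s a) =
      {i | s < c.len i ∧ c.color i + (((c.len i : ℤ) - 1 : ℤ) : ZMod n) = a}.ncard := by
  have : socle C x s a = Submodule.span F (b '' {p | (p.2 : ℕ) = 0 ∧ s < c.len p.1 ∧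
      c.color p.1 + (((c.len p.1 : ℤ) - 1 : ℤ) : ZMod n) = a}) := by
    refine le_antisymm (fun u hu => mem_span_image_box fun i j hj h => ?_) ?_
    · obtain ⟨⟨h1, w, rfl⟩, h3⟩ := hu
      have hj0 : j = 0 := by
        by_contra hj0
        refine h ?_
        have := hb.coordAt_apply (i := i) (k := j) (by omega) ((x ^ s) w)
        rw [← this, LinearMap.mem_ker.1 h1, map_zero]
      subst hj0
      refine ⟨rfl, ?_, ?_⟩
      · by_contra hs
        rw [hb.coordAt_pow_apply (by omega), coordAt_eq_zero] at h
        · exact h rfl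
        · simp only at hs
          omega
      · simpa using hb.color_eq_of_coordAt_ne_zero hC h3 h
    · rw [Submodule.span_le]
      rintro _ ⟨⟨i, j, hj⟩, ⟨h1, h2, h3⟩, rfl⟩
      simp only at h1 h2 h3
      subst h1
      refine ⟨⟨hb.apply_first i hj, ⟨basisVector c b i (s + 1), ?_⟩⟩, ?_⟩
      · rw [hb.pow_apply_basisVector (by omega), ← basisVector_add_one i 0 hj]
        congr 1
        push_cast
        ring
      · have := hb.mem_color ⟨i, ⟨0, hj⟩⟩
        simp only [ColoredPartition.boxColor] at this
        rw [← h3]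
        simpa using this
  rw [this, finrank_span_image_box, ← Nat.card_coe_set_eq]
  refine Nat.card_congr
    { toFun := fun p => ⟨p.1.1, p.2.2⟩
      invFun := fun i => ⟨⟨i.1, ⟨0, (Nat.zero_le s).trans_lt i.2.1⟩⟩, rfl, i.2⟩
      left_inv := ?_
      right_inv := fun i => rfl }
  rintro ⟨⟨i, j, hj⟩, h1, h2⟩
  simp only at h1
  subst h1
  rfl

end Coordinates

/-! ### Uniqueness of the colored Jordan type up to permutation of rows -/

/-- Equality of colored partitions up to the permutation `σ` of the rows. -/
def ColoredPartition.PermutedBy {n : ℕ} (c d : ColoredPartition n) (σ : Equiv.Perm ℕ) : Prop :=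
  ∀ i, d.len i = c.len (σ i) ∧ d.color i = c.color (σ i)

theorem ColoredPartition.finite_len_pos {n : ℕ} (c : ColoredPartition n) :
    {i | 0 < c.len i}.Finite := by
  refine (Finset.range c.length).finite_toSet.subset fun i hi => ?_
  simpa using (c.len_pos_iff i).1 hi

theorem ColoredPartition.infinite_len_zero {n : ℕ} (c : ColoredPartition n) (e : ZMod n) :
    {i | c.len i = 0 ∧ c.color i = e}.Infinite := by
  refine ((c.infinite_color e).sdiff c.finite_len_pos).mono fun i hi => ?_
  have := hi.2
  simp only [Set.mem_ofPred_eq] at this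
  exact ⟨by omega, hi.1⟩

/-- Two colored partitions with equally many rows of each positive length and color differ by a
permutation of the rows. -/
theorem ColoredPartition.exists_permutedBy {n : ℕ} {c d : ColoredPartition n}
    (h : ∀ l e, 0 < l → {i | c.len i = l ∧ c.color i = e}.ncard =
      {i | d.len i = l ∧ d.color i = e}.ncard) :
    ∃ σ : Equiv.Perm ℕ, c.PermutedBy d σ := by
  -- Fibers over a positive length are finite of equal size. Fibers over length `0` are countably
  -- infinite on both sides, since every color occurs infinitely often, so they need no hypothesis.
  have key : ∀ t : ℕ × ZMod n, Nonempty ({i // (d.len i, d.color i) = t} ≃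
      {i // (c.len i, c.color i) = t}) := by
    rintro ⟨l, e⟩
    rcases Nat.eq_zero_or_pos l with rfl | hl
    · have h1 := (c.infinite_len_zero e).to_subtype
      have h2 := (d.infinite_len_zero e).to_subtype
      simp only [Prod.mk.injEq]
      obtain ⟨e1⟩ := nonempty_equiv_of_countable (α := {i | d.len i = 0 ∧ d.color i = e})
        (β := {i | c.len i = 0 ∧ c.color i = e})
      exact ⟨e1⟩
    · have f1 : {i | c.len i = l ∧ c.color i = e}.Finite :=
        c.finite_len_pos.subset fun i hi => by
          have := hi.1
          simp only [Set.mem_ofPred_eq]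
          omega
      have f2 : {i | d.len i = l ∧ d.color i = e}.Finite :=
        d.finite_len_pos.subset fun i hi => by
          have := hi.1
          simp only [Set.mem_ofPred_eq]
          omega
      have := f1.to_subtype
      have := f2.to_subtype
      have h' := h l e hl
      rw [← Nat.card_coe_set_eq, ← Nat.card_coe_set_eq] at h'
      simp only [Prod.mk.injEq]
      have e1 : {i | d.len i = l ∧ d.color i = e} ≃ {i | c.len i = l ∧ c.color i = e} :=
        (Finite.equivFinOfCardEq rfl).trans (Finite.equivFinOfCardEq h').symm
      exact ⟨e1⟩
  let E := fun t => (key t).some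
  refine ⟨(Equiv.sigmaFiberEquiv fun i => (d.len i, d.color i)).symm.trans
    ((Equiv.sigmaCongrRight E).trans (Equiv.sigmaFiberEquiv fun i => (c.len i, c.color i))),
    fun i => ?_⟩
  have := (E (d.len i, d.color i) ⟨i, rfl⟩).2
  simp only [Prod.mk.injEq] at this
  exact ⟨this.1.symm, this.2.symm⟩

section Uniqueness

variable {F : Type*} [Field F] {V : Type*} [AddCommGroup V] [Module F V] {n : ℕ}
  {C : ZMod n → Submodule F V} {c d : ColoredPartition n} {x : Module.End F V}

/-- Rows of length exactly `l` are those longer than `l - 1` but not longer than `l`. The color is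
recorded at the first box, as `finrank_socle` sees it; for given length it determines `ε_i`. -/
theorem ncard_row_eq (c : ColoredPartition n) (l : ℕ) (e : ZMod n) (hl : 0 < l) :
    {i | c.len i = l ∧ c.color i = e}.ncard =
      {i | l - 1 < c.len i ∧ c.color i + (((c.len i : ℤ) - 1 : ℤ) : ZMod n) =
        e + (((l : ℤ) - 1 : ℤ) : ZMod n)}.ncard -
      {i | l < c.len i ∧ c.color i + (((c.len i : ℤ) - 1 : ℤ) : ZMod n) =
        e + (((l : ℤ) - 1 : ℤ) : ZMod n)}.ncard := by
  have hfin : {i | l < c.len i ∧ c.color i + (((c.len i : ℤ) - 1 : ℤ) : ZMod n) =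
      e + (((l : ℤ) - 1 : ℤ) : ZMod n)}.Finite := by
    refine c.finite_len_pos.subset ?_
    rintro i ⟨h1, h2⟩
    simp only [Set.mem_ofPred_eq]
    omega
  rw [← Set.ncard_sdiff _ hfin]
  · congr 1
    ext i
    simp only [Set.mem_ofPred_eq, Set.mem_sdiff, not_and]
    constructor
    · rintro ⟨rfl, rfl⟩
      exact ⟨⟨by omega, rfl⟩, fun h => absurd h (by omega)⟩
    · rintro ⟨⟨h1, h2⟩, h3⟩
      have : c.len i = l := by
        by_contra h
        exact h3 (by omega) h2
      subst this
      exact ⟨rfl, by simpa using h2⟩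
  · rintro i ⟨h1, h2⟩
    exact ⟨by omega, h2⟩

/-- A colored Jordan type is unique up to a permutation of the rows. -/
theorem HasColoredJordanType.exists_permutedBy (hC : DirectSum.IsInternal C)
    (hc : HasColoredJordanType C x c) (hd : HasColoredJordanType C x d) :
    ∃ σ : Equiv.Perm ℕ, c.PermutedBy d σ := by
  obtain ⟨b, hb⟩ := hc
  obtain ⟨b', hb'⟩ := hd
  refine ColoredPartition.exists_permutedBy fun l e hl => ?_
  rw [ncard_row_eq c l e hl, ncard_row_eq d l e hl, ← hb.finrank_socle hC, ← hb'.finrank_socle hC,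
    ← hb.finrank_socle hC, ← hb'.finrank_socle hC]

theorem HasColoredJordanType.of_permutedBy {σ : Equiv.Perm ℕ} (hc : HasColoredJordanType C x c)
    (hσ : c.PermutedBy d σ) : HasColoredJordanType C x d := by
  obtain ⟨b, hb⟩ := hc
  let e : d.Box ≃ c.Box := Equiv.sigmaCongr σ fun i => finCongr (hσ i).1
  have he : ∀ i j (h : j < d.len i),
      b.reindex e.symm ⟨i, ⟨j, h⟩⟩ = b ⟨σ i, ⟨j, (hσ i).1 ▸ h⟩⟩ := fun i j h => by
    rw [Module.Basis.reindex_apply]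
    rfl
  refine ⟨b.reindex e.symm, ⟨?_, fun i h => ?_, fun i j h => ?_⟩⟩
  · rintro ⟨i, j, h⟩
    rw [he]
    have hcol : d.boxColor ⟨i, ⟨j, h⟩⟩ = c.boxColor ⟨σ i, ⟨j, (hσ i).1 ▸ h⟩⟩ := by
      simp only [ColoredPartition.boxColor, (hσ i).1, (hσ i).2]
    rw [hcol]
    exact hb.mem_color _
  · rw [he, hb.apply_first]
  · rw [he, he, hb.apply_succ]

end Uniqueness

/-! ### Orbits and transport of bases -/

section Transport

variable {F : Type*} [Field F] {V : Type*} [AddCommGroup V] [Module F V] {n : ℕ}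
  {C : ZMod n → Submodule F V}

theorem orbitOf_eq_iff {v w : V} {x y : NilCone C} :
    orbitOf C v x = orbitOf C w y ↔
      ∃ g ∈ colorGroup C, g w = v ∧ ∀ u, g (y.1 u) = x.1 (g u) := by
  constructor
  · intro h
    obtain ⟨g, hg⟩ := Quotient.exact h
    refine ⟨g.1, g.2, congrArg Prod.fst hg, fun u => ?_⟩
    have h2 : g • y = x := congrArg Prod.snd hg
    rw [← h2]
    change g.1 (y.1 u) = g.1 (y.1 (g.1.symm (g.1 u)))
    rw [LinearEquiv.symm_apply_apply]
  · rintro ⟨g, hg, hv, hx⟩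
    refine Quotient.sound ⟨⟨g, hg⟩, Prod.ext hv (Subtype.ext (LinearMap.ext fun u => ?_))⟩
    change g (y.1 (g.symm u)) = x.1 u
    rw [hx, LinearEquiv.apply_symm_apply]

theorem basisVector_map {c : ColoredPartition n} (b : Module.Basis c.Box F V) (g : V ≃ₗ[F] V)
    (i : ℕ) (k : ℤ) : basisVector c (b.map g) i k = g (basisVector c b i k) := by
  unfold basisVector
  split_ifs
  · simp
  · simp

theorem markedVector_map (P : MarkedColoredPartition n) (b : Module.Basis P.Box F V)
    (g : V ≃ₗ[F] V) : markedVector P (b.map g) = g (markedVector P b) := by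
  simp only [markedVector, map_sum, basisVector_map]

/-- The group element joining two representatives of the orbit carries a Jordan basis along. So
`Ψ(P) = O` can be tested on any chosen representative `(v, x)`, and two parameters of one orbit give
two bases for the same pair. -/
theorem correspondsTo_orbitOf_iff [FiniteDimensional F V] [NeZero n] (hC : DirectSum.IsInternal C)
    {P : MarkedColoredPartition n} {v : V} {x : NilCone C} :
    CorrespondsTo C hC P (orbitOf C v x) ↔
      ∃ b : Module.Basis P.Box F V,
        IsColoredJordanBasis C x.1 P.toColoredPartition b ∧ v = markedVector P b := by
  constructor
  · rintro ⟨h, hP⟩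
    obtain ⟨O, y, b, hb, -⟩ := exists_psi hC ⟨P, h⟩
    rw [psi_eq hC ⟨P, h⟩ hb, eq_comm, orbitOf_eq_iff] at hP
    obtain ⟨g, hg, hv, hx⟩ := hP
    refine ⟨b.map g, ⟨fun p => ?_, fun i h => ?_, fun i j h => ?_⟩, ?_⟩
    · exact (hg _ _).2 (hb.mem_color p)
    · rw [Module.Basis.map_apply, ← hx, hb.apply_first, map_zero]
    · rw [Module.Basis.map_apply, ← hx, hb.apply_succ, Module.Basis.map_apply]
    · rw [markedVector_map, hv]
  · rintro ⟨b, hb, rfl⟩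
    exact ⟨hb.signature_eq hC, psi_eq hC _ hb⟩

end Transport

/-- Integers congruent modulo `n` differ by a multiple of `n`. This is how inequalities with slack
`n` still pin down marks of a given color. -/
theorem le_of_lt_add_of_cast_eq {n : ℕ} {k l : ℤ} (h : k < l + n)
    (hkl : (k : ZMod n) = (l : ZMod n)) : k ≤ l := by
  rw [ZMod.intCast_eq_intCast_iff_dvd_sub] at hkl
  obtain ⟨t, ht⟩ := hkl
  by_contra hlt
  have : t ≤ -1 := by
    by_contra h
    have : 0 ≤ (n : ℤ) * t := mul_nonneg (by omega) (by omega)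
    omega
  nlinarith

/-! ### Color-preserving endomorphisms commuting with `x` -/

section Centralizer

variable {F : Type*} [Field F] {V : Type*} [AddCommGroup V] [Module F V] {n : ℕ}
  {C : ZMod n → Submodule F V} {c : ColoredPartition n} {b : Module.Basis c.Box F V}
  {x : Module.End F V}

theorem pow_apply_mem (hx : ∀ i, ∀ v ∈ C i, x v ∈ C (i + 1)) {a : ZMod n} {v : V} (hv : v ∈ C a)
    (s : ℕ) : (x ^ s) v ∈ C (a + (s : ZMod n)) := by
  induction s with
  | zero => simpa using hv
  | succ s ih =>
    rw [pow_succ', Module.End.mul_apply]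
    push_cast
    rw [← add_assoc]
    exact hx _ _ ih

/-- A color-preserving endomorphism that commutes with `x` can be prescribed on the last vectors
of the rows of a colored Jordan basis. -/
theorem IsColoredJordanBasis.exists_end (hC : DirectSum.IsInternal C)
    (hx : ∀ i, ∀ v ∈ C i, x v ∈ C (i + 1)) (hb : IsColoredJordanBasis C x c b) (w : ℕ → V)
    (hw : ∀ i, w i ∈ C (c.color i)) (hw0 : ∀ i, (x ^ c.len i) (w i) = 0) :
    ∃ T : Module.End F V, (∀ u, T (x u) = x (T u)) ∧ (∀ m, ∀ u ∈ C m, T u ∈ C m) ∧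
      ∀ i (k : ℤ), k ≤ c.len i →
        T (basisVector c b i k) = (x ^ ((c.len i : ℤ) - k).toNat) (w i) := by
  -- The box in zero-based column `j` is `x ^ (λ_i - 1 - j)` applied to the last vector of its row,
  -- so its image is forced.
  let T : Module.End F V := b.constr F fun p => (x ^ (c.len p.1 - 1 - p.2)) (w p.1)
  have hT : ∀ i (k : ℤ), k ≤ c.len i →
      T (basisVector c b i k) = (x ^ ((c.len i : ℤ) - k).toNat) (w i) := by
    intro i k hk
    by_cases h0 : 0 < k
    · obtain ⟨j, hj, rfl⟩ := exists_box_of_pos h0 hk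
      rw [basisVector_add_one i j hj, Module.Basis.constr_basis]
      congr 2
      simp only
      omega
    · have h1 : ((c.len i : ℤ) - k).toNat = (-k).toNat + c.len i := by omega
      rw [basisVector_of_nonpos (by omega), map_zero, h1, pow_add, Module.End.mul_apply, hw0,
        map_zero]
  refine ⟨T, fun u => ?_, ?_, hT⟩
  · have : T ∘ₗ x = x ∘ₗ T := by
      refine linearMap_ext_basisVector b fun i k h0 hk => ?_
      have h1 : ((c.len i : ℤ) - (k - 1)).toNat = ((c.len i : ℤ) - k).toNat + 1 := by omega
      rw [LinearMap.comp_apply, LinearMap.comp_apply, hb.apply_basisVector hk,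
        hT _ _ (by omega), hT _ _ hk, h1, pow_succ', Module.End.mul_apply]
    exact LinearMap.congr_fun this u
  · refine map_mem_of_colored (D := C) hC b hb.mem_color T ?_
    rintro ⟨i, j, hj⟩
    rw [Module.Basis.constr_basis]
    have := pow_apply_mem hx (hw i) (c.len i - 1 - j)
    convert this using 2
    simp only [ColoredPartition.boxColor]
    rw [← Int.cast_natCast (R := ZMod n) (c.len i - 1 - j)]
    congr 2
    omega

/-- An injective color-preserving endomorphism that commutes with `x` does not change the orbit. -/
theorem orbitOf_apply_eq [FiniteDimensional F V] {x : NilCone C} {T : Module.End F V}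
    (hinj : Function.Injective T) (hT : ∀ u, T (x.1 u) = x.1 (T u))
    (hTC : ∀ m, ∀ u ∈ C m, T u ∈ C m) (v : V) : orbitOf C (T v) x = orbitOf C v x := by
  let g : V ≃ₗ[F] V := LinearEquiv.ofInjectiveEndo T hinj
  have hg : ∀ u, g u = T u := fun u => rfl
  refine orbitOf_eq_iff.2 ⟨g, fun m u => ⟨fun h => ?_, hTC m u⟩, rfl, hT⟩
  -- By injectivity and equal dimension `T` maps `C m` onto itself, so its inverse preserves colors
  -- too.
  have hle : (C m).map T ≤ C m := by
    rintro _ ⟨w, hw, rfl⟩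
    exact hTC m w hw
  have heq : (C m).map T = C m :=
    Submodule.eq_of_le_of_finrank_eq hle
      (LinearEquiv.finrank_eq (Submodule.equivMapOfInjective T hinj (C m))).symm
  rw [← heq] at h
  obtain ⟨w, hw, hwu⟩ := h
  rwa [← hinj hwu]

/-- A linear map that intertwines a nilpotent endomorphism is injective as soon as it is injective
on the kernel of that endomorphism. -/
theorem injective_of_injective_on_ker {T : Module.End F V} (hx : IsNilpotent x)
    (hT : ∀ u, T (x u) = x (T u)) (hker : ∀ u, x u = 0 → T u = 0 → u = 0) :
    Function.Injective T := by
  rw [injective_iff_map_eq_zero]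
  obtain ⟨k, hk⟩ := hx
  have key : ∀ s u, (x ^ s) u = 0 → T u = 0 → u = 0 := by
    intro s
    induction s with
    | zero => intro u hu _; simpa using hu
    | succ s ih =>
      intro u hu hTu
      -- The kernel of `T` is stable under `x`, so the induction applies to `x u` and shows that `u`
      -- lies in `ker x`.
      refine hker u (ih (x u) ?_ ?_) hTu
      · rwa [pow_succ, Module.End.mul_apply] at hu
      · rw [hT, hTu, map_zero]
  exact fun u hu => key k u (by rw [hk, LinearMap.zero_apply]) hu

/-- If `x ^ s` kills `u`, then coefficients of vectors in row `i` and column beyond `s` vanish. -/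
theorem IsColoredJordanBasis.le_of_coordAt_ne_zero (hb : IsColoredJordanBasis C x c b) {s : ℕ}
    {u : V} (hu : (x ^ s) u = 0) {i : ℕ} {k : ℤ} (h : coordAt c b i k u ≠ 0) : k ≤ s := by
  by_contra hk
  have := hb.coordAt_pow_apply (i := i) (k := k - s) (by omega) s u
  rw [hu, map_zero, sub_add_cancel] at this
  exact h this.symm

/-- Each application of `x` shifts columns to the left by one, so the image of `x ^ s` misses the
last `s` columns of every row. -/
theorem IsColoredJordanBasis.add_le_of_coordAt_ne_zero (hb : IsColoredJordanBasis C x c b)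
    {s : ℕ} {u : V} {i : ℕ} {k : ℤ} (h : coordAt c b i k ((x ^ s) u) ≠ 0) :
    k + s ≤ c.len i := by
  have h0 : 0 < k := by
    by_contra h0
    rw [coordAt_eq_zero (by omega)] at h
    exact h rfl
  rw [hb.coordAt_pow_apply h0] at h
  by_contra hk
  rw [coordAt_eq_zero (by omega)] at h
  exact h rfl

end Centralizer

/-! ### Uniqueness of the marks -/

section Marks

variable {F : Type*} [Field F] {V : Type*} [AddCommGroup V] [Module F V] {n : ℕ}
  {C : ZMod n → Submodule F V} {x : Module.End F V} {P Q : MarkedColoredPartition n}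
  {b : Module.Basis P.Box F V} {d : Module.Basis Q.Box F V}

theorem markedVector_mem (hb : IsColoredJordanBasis C x P.toColoredPartition b) {m : ZMod n}
    (hP : ∀ i, 0 < P.mark i → P.markColor i = m) : markedVector P b ∈ C m := by
  refine Submodule.sum_mem _ fun i _ => ?_
  by_cases h : 0 < P.mark i
  · rw [← hP i h]
    exact hb.basisVector_mem i (P.mark i)
  · rw [basisVector_of_nonpos (by omega)]
    exact Submodule.zero_mem _

theorem coordAt_mark_markedVector {i : ℕ} (h : 0 < P.mark i) :
    coordAt P.toColoredPartition b i (P.mark i) (markedVector P b) = 1 := by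
  rw [markedVector, map_sum, Finset.sum_eq_single i]
  · rw [coordAt_basisVector h (P.mark_le i), if_pos ⟨rfl, rfl⟩]
  · intro j _ hj
    by_cases h' : 0 < P.mark j
    · rw [coordAt_basisVector h' (P.mark_le j), if_neg]
      rintro ⟨rfl, -⟩
      exact hj rfl
    · rw [basisVector_of_nonpos (by omega), map_zero]
  · intro hi
    have := P.mark_le i
    rw [Finset.mem_range, ← P.len_pos_iff] at hi
    omega

theorem markedVector_eq_zero_iff : markedVector P b = 0 ↔ ∀ i, P.mark i ≤ 0 := by
  constructor
  · intro h i
    by_contra hi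
    have := coordAt_mark_markedVector (b := b) (i := i) (by omega)
    rw [h, map_zero] at this
    exact zero_ne_one this
  · intro h
    exact Finset.sum_eq_zero fun i _ => basisVector_of_nonpos (h i)

/-- A row of `Q` cannot have a larger mark than the corresponding row of `P`, if `Q` describes the
same vector as the colored quasi-bipartition `P`. -/
theorem mark_le_of_markedVector_eq [NeZero n] (hC : DirectSum.IsInternal C)
    (hx : ∀ i, ∀ v ∈ C i, x v ∈ C (i + 1))
    (hb : IsColoredJordanBasis C x P.toColoredPartition b)
    (hd : IsColoredJordanBasis C x Q.toColoredPartition d)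
    (hP : P.IsColoredQuasiBipartition) (hv : markedVector P b = markedVector Q d) {i i' : ℕ}
    (hlen : Q.len i' = P.len i) (hcol : Q.color i' = P.color i)
    (hmc : P.markColor i = Q.markColor i') (hpos : 0 < Q.mark i') : Q.mark i' ≤ P.mark i := by
  classical
  have hQle := Q.mark_le i'
  -- `T` carries row `i'` of the basis `d` onto row `i` of the basis `b` and kills the other rows of
  -- `d`.
  obtain ⟨T, hTx, -, hT⟩ := hd.exists_end hC hx
    (fun j => if j = i' then basisVector P.toColoredPartition b i (P.len i) else 0)
    (fun j => by
      split_ifs with h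
      · subst h
        rw [hcol]
        simpa using hb.basisVector_mem i (P.len i)
      · exact Submodule.zero_mem _)
    (fun j => by
      split_ifs with h
      · subst h
        rw [hb.pow_apply_basisVector le_rfl, basisVector_of_nonpos (by omega)]
      · exact map_zero _)
  have hTv : T (markedVector Q d) = basisVector P.toColoredPartition b i (Q.mark i') := by
    rw [markedVector, map_sum, Finset.sum_eq_single i']
    · rw [hT _ _ (Q.mark_le i'), if_pos rfl, hb.pow_apply_basisVector le_rfl]
      congr 1
      omega
    · intro j _ hj
      rw [hT _ _ (Q.mark_le j), if_neg hj, map_zero]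
    · intro hi
      rw [Finset.mem_range, ← Q.len_pos_iff] at hi
      omega
  have hTpow : ∀ s u, T ((x ^ s) u) = (x ^ s) (T u) := by
    intro s
    induction s with
    | zero => intro u; simp
    | succ s ih =>
      intro u
      rw [pow_succ, Module.End.mul_apply, ih, hTx, Module.End.mul_apply]
  -- Expanding the same vector along `b` instead, some `v_{j,μ_j}` must contribute to this
  -- coefficient of its image.
  have h1 : coordAt P.toColoredPartition b i (Q.mark i') (T (markedVector P b)) ≠ 0 := by
    rw [hv, hTv, coordAt_basisVector hpos (by omega), if_pos ⟨rfl, rfl⟩]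
    exact one_ne_zero
  rw [markedVector, map_sum, map_sum] at h1
  obtain ⟨j, -, hj⟩ := Finset.exists_ne_zero_of_sum_ne_zero h1
  have hjpos : 0 < P.mark j := by
    by_contra h
    rw [basisVector_of_nonpos (by omega), map_zero, map_zero] at hj
    exact hj rfl
  have hjle := P.mark_le j
  -- `x ^ μ_j` kills `v_{j,μ_j}`, hence also its image under `T`.
  have h2 : Q.mark i' ≤ P.mark j := by
    have : (x ^ (P.mark j).toNat) (T (basisVector P.toColoredPartition b j (P.mark j))) = 0 := by
      rw [← hTpow, hb.pow_apply_basisVector hjle, basisVector_of_nonpos (by omega), map_zero]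
    have := hb.le_of_coordAt_ne_zero this hj
    omega
  -- `v_{j,μ_j}` lies in the image of `x ^ ν_j`, hence so does its image under `T`.
  have h3 : Q.mark i' + P.nu j ≤ P.len i := by
    have h4 : basisVector P.toColoredPartition b j (P.mark j) =
        (x ^ (P.nu j).toNat) (basisVector P.toColoredPartition b j (P.len j)) := by
      rw [hb.pow_apply_basisVector le_rfl]
      congr 1
      simp only [MarkedColoredPartition.nu]
      omega
    rw [h4, hTpow] at hj
    have := hb.add_le_of_coordAt_ne_zero hj
    simp only [MarkedColoredPartition.nu] at this ⊢
    omega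
  -- If `i < j`, `h2` and the inequality for `μ` suffice; if `j < i`, `h3` and the one for `ν` do.
  have h5 : Q.mark i' < P.mark i + n := by
    rcases lt_trichotomy i j with h | rfl | h
    · have := (hP.2.1 i j h).1
      omega
    · have := NeZero.pos n
      omega
    · have := (hP.2.1 j i h).2
      simp only [MarkedColoredPartition.nu] at this h3
      omega
  have h6 : ((Q.mark i' : ℤ) : ZMod n) = (P.mark i : ℤ) := by
    simp only [MarkedColoredPartition.markColor, MarkedColoredPartition.nu, hlen, hcol,
      add_right_inj] at hmc
    push_cast at hmc
    exact (sub_right_inj.1 hmc).symm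
  exact le_of_lt_add_of_cast_eq h5 h6

end Marks

section Marks

variable {F : Type*} [Field F] {V : Type*} [AddCommGroup V] [Module F V] {n : ℕ}
  {C : ZMod n → Submodule F V} {x : Module.End F V} {P Q : MarkedColoredPartition n}
  {b : Module.Basis P.Box F V} {d : Module.Basis Q.Box F V}

theorem mark_cast_eq_of_markColor_eq {i j : ℕ} (hlen : Q.len i = P.len j)
    (hcol : Q.color i = P.color j) (h : Q.markColor i = P.markColor j) :
    ((Q.mark i : ℤ) : ZMod n) = (P.mark j : ℤ) := by
  simp only [MarkedColoredPartition.markColor, MarkedColoredPartition.nu, hlen, hcol,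
    add_right_inj] at h
  push_cast at h
  exact sub_right_inj.1 h

/-- The marks of a colored quasi-bipartition are determined by the nonzero vector it describes. -/
theorem rowEquiv_of_markedVector_eq [NeZero n] (hC : DirectSum.IsInternal C)
    (hx : ∀ i, ∀ v ∈ C i, x v ∈ C (i + 1))
    (hb : IsColoredJordanBasis C x P.toColoredPartition b)
    (hd : IsColoredJordanBasis C x Q.toColoredPartition d)
    (hP : P.IsColoredQuasiBipartition) (hQ : Q.IsColoredQuasiBipartition)
    (hv : markedVector P b = markedVector Q d) (h0 : markedVector P b ≠ 0) : P.RowEquiv Q := by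
  obtain ⟨σ, hσ⟩ := HasColoredJordanType.exists_permutedBy hC ⟨b, hb⟩ ⟨d, hd⟩
  have hmc : ∀ i j, P.markColor i = Q.markColor j := by
    -- A nonzero vector has only one color, so both markings have the same mark color.
    obtain ⟨i₀, hi₀⟩ : ∃ i, 0 < P.mark i := by
      by_contra h
      exact h0 (markedVector_eq_zero_iff.2 fun i => by
        by_contra hi
        exact h ⟨i, by omega⟩)
    intro i j
    have hmem : markedVector P b ∈ C (Q.markColor j) :=
      hv ▸ markedVector_mem hd fun i _ => hQ.2.2 i j
    have hcoord := coordAt_mark_markedVector (b := b) hi₀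
    rw [hP.2.2 i i₀]
    exact hb.color_eq_of_coordAt_ne_zero hC hmem (hcoord ▸ one_ne_zero)
  refine ⟨σ, fun i => ⟨(hσ i).1, (hσ i).2, ?_⟩⟩
  have h1 : 0 < Q.mark i → Q.mark i ≤ P.mark (σ i) := fun h =>
    mark_le_of_markedVector_eq hC hx hb hd hP hv (hσ i).1 (hσ i).2 (hmc _ _) h
  have h2 : 0 < P.mark (σ i) → P.mark (σ i) ≤ Q.mark i := fun h =>
    mark_le_of_markedVector_eq hC hx hd hb hQ hv.symm (hσ i).1.symm (hσ i).2.symm (hmc _ _).symm h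
  have h3 := mark_cast_eq_of_markColor_eq (hσ i).1 (hσ i).2 (hmc (σ i) i).symm
  have h4 := hP.1 (σ i)
  have h5 := hQ.1 i
  -- If a mark is positive, the two comparisons `h1` and `h2` give equality; otherwise both lie in
  -- `(-n, 0]` and are congruent.
  by_cases h : 0 < Q.mark i ∨ 0 < P.mark (σ i)
  · omega
  · exact le_antisymm (le_of_lt_add_of_cast_eq (by omega) h3)
      (le_of_lt_add_of_cast_eq (by omega) h3.symm)

theorem MarkedColoredPartition.RowEquiv.weakEquiv (h : P.RowEquiv Q) : P.WeakEquiv Q := by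
  obtain ⟨σ, h⟩ := h
  exact ⟨σ, fun i => ⟨(h i).1, (h i).2.1, fun _ => (h i).2.2⟩⟩

/-! ### Markings in `(-n, 0]` and the operations `ρ_m` -/

namespace MarkedColoredPartition

/-- Two marks in `(-n, 0]` differ by less than `n`, and since `λ` decreases the same slack serves
for `ν`. -/
theorem isColoredQuasiBipartition_of_nonpos {m : ZMod n} (h0 : ∀ i, P.mark i ≤ 0)
    (h1 : ∀ i, -(n : ℤ) < P.mark i) (h2 : ∀ i, P.markColor i = m) :
    P.IsColoredQuasiBipartition := by
  refine ⟨h1, fun i j hij => ?_, fun i j => (h2 i).trans (h2 j).symm⟩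
  have := P.len_antitone hij.le
  have := h0 i
  have := h0 j
  have := h1 i
  have := h1 j
  simp only [nu]
  omega

variable [NeZero n]

theorem rho_mark_mem (m : ZMod n) (P : MarkedColoredPartition n) (i : ℕ) :
    (P.rho m).mark i ∈ rhoCandidates m P i :=
  Int.csSup_mem (rhoCandidates_nonempty m P i) ⟨P.mark i, fun _ hk => hk.1⟩

theorem le_rho_mark {m : ZMod n} {i : ℕ} {k : ℤ} (h : k ∈ rhoCandidates m P i) :
    k ≤ (P.rho m).mark i :=
  le_csSup ⟨P.mark i, fun _ hk => hk.1⟩ h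

theorem rho_mark_le (m : ZMod n) (P : MarkedColoredPartition n) (i : ℕ) :
    (P.rho m).mark i ≤ P.mark i :=
  (rho_mark_mem m P i).1

theorem rho_markColor (m : ZMod n) (P : MarkedColoredPartition n) (i : ℕ) :
    (P.rho m).markColor i = m :=
  (rho_mark_mem m P i).2

/-- Otherwise adding `n`, which keeps the color, would give a larger candidate. -/
theorem lt_rho_mark (m : ZMod n) (P : MarkedColoredPartition n) (i : ℕ) :
    P.mark i - n < (P.rho m).mark i := by
  by_contra h
  have h1 := rho_mark_mem m P i
  have h2 := le_rho_mark (P := P) (m := m) (i := i) (k := (P.rho m).mark i + n)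
    ⟨by omega, by
      have := h1.2
      push_cast at this ⊢
      refine Eq.trans ?_ this
      simp⟩
  have := NeZero.pos n
  omega

/-- The interval `(-n, 0]` contains one representative of each class modulo `n`, so the color fixes
the mark. -/
theorem rho_zeroMarking_mark_eq {c : ColoredPartition n} {m : ZMod n} {i j : ℕ}
    (hlen : P.len i = c.len j) (hcol : P.color i = c.color j) (h0 : P.mark i ≤ 0)
    (h1 : -(n : ℤ) < P.mark i) (h2 : P.markColor i = m) :
    P.mark i = (c.zeroMarking.rho m).mark j := by
  have h3 := mark_cast_eq_of_markColor_eq (Q := P) (P := c.zeroMarking.rho m) hlen hcol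
    (h2.trans (rho_markColor m c.zeroMarking j).symm)
  have h4 : (c.zeroMarking.rho m).mark j ≤ 0 := rho_mark_le m c.zeroMarking j
  have h5 : 0 - (n : ℤ) < (c.zeroMarking.rho m).mark j := lt_rho_mark m c.zeroMarking j
  exact le_antisymm (le_of_lt_add_of_cast_eq (by omega) h3)
    (le_of_lt_add_of_cast_eq (by omega) h3.symm)

theorem rho_zeroMarking_isColoredQuasiBipartition (m : ZMod n) (c : ColoredPartition n) :
    (c.zeroMarking.rho m).IsColoredQuasiBipartition := by
  refine isColoredQuasiBipartition_of_nonpos (m := m) (fun i => rho_mark_le m c.zeroMarking i)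
    (fun i => ?_) (rho_markColor m c.zeroMarking)
  have : 0 - (n : ℤ) < (c.zeroMarking.rho m).mark i := lt_rho_mark m c.zeroMarking i
  omega

end MarkedColoredPartition

end Marks

/-! ### Raising marks to reach a generalized quasi-bipartition -/

/-- The marked colored partition with a given marking. -/
def ColoredPartition.withMark {n : ℕ} (c : ColoredPartition n) (μ : ℕ → ℤ)
    (hμ : ∀ i, μ i ≤ c.len i) : MarkedColoredPartition n :=
  { c with mark := μ, mark_le := hμ }

section Raising

variable {F : Type*} [Field F] {V : Type*} [AddCommGroup V] [Module F V] {n : ℕ}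
  {C : ZMod n → Submodule F V} {c : ColoredPartition n} {b : Module.Basis c.Box F V}

/-- The vector `∑ v_{i, μ_i}`. -/
noncomputable def rowSum (c : ColoredPartition n) (b : Module.Basis c.Box F V) (μ : ℕ → ℤ) : V :=
  ∑ i ∈ Finset.range c.length, basisVector c b i (μ i)

theorem markedVector_eq_rowSum (P : MarkedColoredPartition n) (b : Module.Basis P.Box F V) :
    markedVector P b = rowSum P.toColoredPartition b P.mark :=
  rfl

theorem rowSum_congr {μ μ' : ℕ → ℤ} (h : ∀ i, μ i = μ' i ∨ μ i ≤ 0 ∧ μ' i ≤ 0) :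
    rowSum c b μ = rowSum c b μ' := by
  refine Finset.sum_congr rfl fun i _ => ?_
  rcases h i with h | h
  · rw [h]
  · rw [basisVector_of_nonpos h.1, basisVector_of_nonpos h.2]

theorem rowSum_update {μ : ℕ → ℤ} {r : ℕ} (hr : 0 < c.len r) (k : ℤ) :
    rowSum c b (Function.update μ r k) =
      rowSum c b μ + (basisVector c b r k - basisVector c b r (μ r)) := by
  have hmem : r ∈ Finset.range c.length := Finset.mem_range.2 ((c.len_pos_iff r).1 hr)
  rw [rowSum, rowSum, ← Finset.add_sum_erase _ _ hmem, ← Finset.add_sum_erase _ _ hmem,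
    Function.update_self]
  have : ∀ i ∈ (Finset.range c.length).erase r,
      basisVector c b i (Function.update μ r k i) = basisVector c b i (μ i) := fun i hi => by
    rw [Function.update_of_ne (Finset.ne_of_mem_erase hi)]
  rw [Finset.sum_congr rfl this]
  abel

/-- The mark of row `r` can be raised by `n`, as long as it does not get past that of row `s`
when counted from either end. -/
theorem orbitOf_rowSum_update [FiniteDimensional F V] (hC : DirectSum.IsInternal C) {x : NilCone C}
    (hb : IsColoredJordanBasis C x.1 c b) {μ : ℕ → ℤ} (hμ : ∀ i, μ i ≤ c.len i) {r s : ℕ}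
    (hrs : r ≠ s)
    (hcol : c.color r + (((c.len r : ℤ) - μ r : ℤ) : ZMod n) =
      c.color s + (((c.len s : ℤ) - μ s : ℤ) : ZMod n))
    (h1 : μ r + n ≤ μ s) (h2 : μ r + n + (c.len s - μ s) ≤ c.len r) :
    orbitOf C (rowSum c b (Function.update μ r (μ r + n))) x = orbitOf C (rowSum c b μ) x := by
  classical
  have hs := hμ s
  by_cases hpos : 0 < μ r + n
  swap
  · congr 1
    refine rowSum_congr fun i => ?_
    by_cases hi : i = r
    · subst hi
      rw [Function.update_self]
      omega
    · rw [Function.update_of_ne hi]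
      exact Or.inl rfl
  have hbs : ∀ i, (x.1 ^ c.len i) (basisVector c b i (c.len i)) = 0 := fun i => by
    rw [hb.pow_apply_basisVector le_rfl, basisVector_of_nonpos (by omega)]
  have hmem : ∀ i, basisVector c b i (c.len i) ∈ C (c.color i) := fun i => by
    simpa using hb.basisVector_mem i (c.len i)
  let l : ℤ := c.len s - μ s
  have hl : l = c.len s - μ s := rfl
  -- The columns `μ_r + l` and `μ_r + n + l` of row `r` have the color of the last box of row `s`,
  -- as `l = ν_s` and the mark colors agree.
  have hd1 : basisVector c b r (μ r + n + l) ∈ C (c.color s) := by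
    convert hb.basisVector_mem r (μ r + n + l) using 2
    rw [← add_left_inj (((c.len s : ℤ) - μ s : ℤ) : ZMod n), ← hcol, hl]
    push_cast
    simp
    ring
  have hd2 : basisVector c b r (μ r + l) ∈ C (c.color s) := by
    convert hb.basisVector_mem r (μ r + l) using 2
    rw [← add_left_inj (((c.len s : ℤ) - μ s : ℤ) : ZMod n), ← hcol, hl]
    push_cast
    ring
  -- `T` adds to row `s` a combination of row `r` chosen so that `v_{s,μ_s}` gains `v_{r,μ_r+n} -
  -- v_{r,μ_r}`. The bound `h2` keeps the columns inside row `r`, and `h1` gives annihilation by `x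
  -- ^ λ_s`.
  obtain ⟨T, hTx, hTC, hT⟩ := hb.exists_end hC x.2.2
    (fun i => if i = s then basisVector c b s (c.len s) +
      (basisVector c b r (μ r + n + l) - basisVector c b r (μ r + l))
      else basisVector c b i (c.len i))
    (fun i => by
      split_ifs with h
      · subst h
        exact Submodule.add_mem _ (hmem _) (Submodule.sub_mem _ hd1 hd2)
      · exact hmem i)
    (fun i => by
      split_ifs with h
      · subst h
        rw [map_add, map_sub, hbs, hb.pow_apply_basisVector (by omega),
          hb.pow_apply_basisVector (by omega), basisVector_of_nonpos (by omega),
          basisVector_of_nonpos (by omega)]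
        simp
      · exact hbs i)
  have hT1 : ∀ i (k : ℤ), i ≠ s → k ≤ c.len i → T (basisVector c b i k) = basisVector c b i k := by
    intro i k hi hk
    rw [hT i k hk, if_neg hi, hb.pow_apply_basisVector le_rfl]
    congr 1
    omega
  have hT2 : ∀ k : ℤ, k ≤ c.len s → T (basisVector c b s k) = basisVector c b s k +
      (basisVector c b r (μ r + n + (k - μ s)) - basisVector c b r (μ r + (k - μ s))) := by
    intro k hk
    rw [hT s k hk, if_pos rfl, map_add, map_sub, hb.pow_apply_basisVector le_rfl,
      hb.pow_apply_basisVector (by omega), hb.pow_apply_basisVector (by omega)]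
    congr 2
    · omega
    · congr 1
      omega
    · congr 1
      omega
  have hinj : Function.Injective T := by
    -- `T - 1` has values in row `r ≠ s`, which `T` fixes; so `T u = 0` implies `u = 0`.
    have hTT : T ∘ₗ (T - LinearMap.id) = T - LinearMap.id := by
      refine linearMap_ext_basisVector b fun i k h0 hk => ?_
      rw [LinearMap.comp_apply, LinearMap.sub_apply, LinearMap.id_apply]
      by_cases hi : i = s
      · subst hi
        rw [hT2 k hk, add_sub_cancel_left, map_sub, hT1 _ _ hrs (by omega),
          hT1 _ _ hrs (by omega)]
      · rw [hT1 i k hi hk, sub_self, map_zero]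
    rw [injective_iff_map_eq_zero]
    intro u hu
    have := LinearMap.congr_fun hTT u
    simpa [hu] using this
  rw [← orbitOf_apply_eq hinj hTx hTC (rowSum c b μ)]
  congr 1
  have hr0 : 0 < c.len r := by omega
  have hs0 : s ∈ Finset.range c.length := by
    rw [Finset.mem_range, ← c.len_pos_iff]
    omega
  rw [rowSum_update hr0, rowSum, map_sum, ← Finset.add_sum_erase _ _ hs0,
    ← Finset.add_sum_erase _ _ hs0, hT2 _ hs]
  have : ∀ i ∈ (Finset.range c.length).erase s,
      T (basisVector c b i (μ i)) = basisVector c b i (μ i) := fun i hi =>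
    hT1 i _ (Finset.ne_of_mem_erase hi) (hμ i)
  rw [Finset.sum_congr rfl this]
  simp only [sub_self, add_zero]
  abel

/-- The sum of the `ν_i` over nonzero rows drops with each raising step, while the marks keep their
classes modulo `n` and stay above `-n`. -/
theorem exists_generalized_of_neg_lt [FiniteDimensional F V] [NeZero n]
    (hC : DirectSum.IsInternal C) {x : NilCone C} (hb : IsColoredJordanBasis C x.1 c b) (N : ℕ)
    (μ : ℕ → ℤ) (hμ : ∀ i, μ i ≤ c.len i) (hμn : ∀ i, -(n : ℤ) < μ i)
    (hN : ∑ i ∈ Finset.range c.length, ((c.len i : ℤ) - μ i).toNat = N) :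
    ∃ (μ' : ℕ → ℤ) (hμ' : ∀ i, μ' i ≤ c.len i),
      (c.withMark μ' hμ').IsGeneralizedQuasiBipartition ∧
      (∀ i, (μ' i : ZMod n) = (μ i : ZMod n)) ∧
      orbitOf C (rowSum c b μ') x = orbitOf C (rowSum c b μ) x := by
  induction N using Nat.strong_induction_on generalizing μ with
  | _ N ih =>
  by_cases hg : (c.withMark μ hμ).IsGeneralizedQuasiBipartition
  · exact ⟨μ, hμ, hg, fun _ => rfl, rfl⟩
  -- For a violating pair `i < j`, row `i` is raised when the inequality for `μ` fails and row `j`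
  -- when that for `ν` fails. As `λ_j ≤ λ_i`, the failure of one inequality yields both bounds `h1`
  -- and `h2`.
  obtain ⟨r, s, hrs, hcol, h1, h2⟩ : ∃ r s, r ≠ s ∧
      c.color r + (((c.len r : ℤ) - μ r : ℤ) : ZMod n) =
        c.color s + (((c.len s : ℤ) - μ s : ℤ) : ZMod n) ∧
      μ r + n ≤ μ s ∧ μ r + n + (c.len s - μ s) ≤ c.len r := by
    by_contra hne
    refine hg ⟨hμn, fun i j hij hcol => ?_⟩
    have hlen := c.len_antitone hij.le
    change μ j < μ i + n ∧ (c.len j : ℤ) - μ j < c.len i - μ i + n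
    constructor
    · by_contra h
      exact hne ⟨i, j, hij.ne, hcol, by omega, by omega⟩
    · by_contra h
      exact hne ⟨j, i, hij.ne', hcol.symm, by omega, by omega⟩
  have hr0 : 0 < c.len r := by
    have := hμn r
    have := hμ s
    omega
  have hn := NeZero.pos n
  have hle : ∀ i, Function.update μ r (μ r + n) i ≤ c.len i := by
    intro i
    by_cases hi : i = r
    · subst hi
      rw [Function.update_self]
      have := hμ s
      omega
    · rw [Function.update_of_ne hi]
      exact hμ i
  obtain ⟨μ', hμ', hg', hcast, horb⟩ := ih _ (by
      rw [← hN]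
      refine Finset.sum_lt_sum (fun i _ => ?_)
        ⟨r, Finset.mem_range.2 ((c.len_pos_iff r).1 hr0), ?_⟩
      · by_cases hi : i = r
        · subst hi
          rw [Function.update_self]
          omega
        · rw [Function.update_of_ne hi]
      · have := hle r
        rw [Function.update_self] at this ⊢
        omega)
    (Function.update μ r (μ r + n)) hle (fun i => by
      by_cases hi : i = r
      · subst hi
        rw [Function.update_self]
        have := hμn i
        omega
      · rw [Function.update_of_ne hi]
        exact hμn i) rfl
  refine ⟨μ', hμ', hg', fun i => ?_, horb.trans (orbitOf_rowSum_update hC hb hμ hrs hcol h1 h2)⟩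
  rw [hcast]
  by_cases hi : i = r
  · subst hi
    rw [Function.update_self]
    simp
  · rw [Function.update_of_ne hi]

/-- Every marking can be replaced by a generalized colored quasi-bipartition with the same colors
of marks and the same orbit. -/
theorem exists_generalized [FiniteDimensional F V] [NeZero n]
    (hC : DirectSum.IsInternal C) {x : NilCone C} (hb : IsColoredJordanBasis C x.1 c b)
    (μ : ℕ → ℤ) (hμ : ∀ i, μ i ≤ c.len i) :
    ∃ (μ' : ℕ → ℤ) (hμ' : ∀ i, μ' i ≤ c.len i),
      (c.withMark μ' hμ').IsGeneralizedQuasiBipartition ∧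
      (∀ i, (μ' i : ZMod n) = (μ i : ZMod n)) ∧
      orbitOf C (rowSum c b μ') x = orbitOf C (rowSum c b μ) x := by
  have hn : (0 : ℤ) < n := by exact_mod_cast NeZero.pos n
  -- Nonpositive marks do not affect the vector, so they may first be moved into `(-n, 0]` within
  -- their classes modulo `n`.
  let μ₀ : ℕ → ℤ := fun i => if 0 < μ i then μ i else -((-μ i) % n)
  have hμ₀ : ∀ i, μ₀ i = μ i ∨ μ₀ i ≤ 0 ∧ μ i ≤ 0 := by
    intro i
    have := Int.emod_nonneg (-μ i) hn.ne'
    simp only [μ₀]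
    split_ifs <;> omega
  obtain ⟨μ', hμ', hg, hcast, horb⟩ := exists_generalized_of_neg_lt hC hb _ μ₀ (fun i => by
      have := hμ₀ i
      have := hμ i
      omega) (fun i => by
      have := Int.emod_lt_of_pos (-μ i) hn
      simp only [μ₀]
      split_ifs <;> omega) rfl
  refine ⟨μ', hμ', hg, fun i => ?_, ?_⟩
  · rw [hcast]
    simp only [μ₀]
    split_ifs
    · rfl
    · rw [Int.emod_def]
      push_cast
      simp
  · rw [horb, rowSum_congr hμ₀]

end Raising

/-! ### Colored vectors as sums of single basis vectors, one per row -/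

section ColoredVector

variable {F : Type*} [Field F] {V : Type*} [AddCommGroup V] [Module F V] {n : ℕ}
  {C : ZMod n → Submodule F V} {c : ColoredPartition n} {b : Module.Basis c.Box F V}

theorem sum_coordAt_smul (b : Module.Basis c.Box F V) (u : V) :
    ∑ i ∈ Finset.range c.length, ∑ k ∈ Finset.Icc (1 : ℤ) (c.len i),
      coordAt c b i k u • basisVector c b i k = u := by
  have : ∑ i ∈ Finset.range c.length, ∑ k ∈ Finset.Icc (1 : ℤ) (c.len i),
      (coordAt c b i k).smulRight (basisVector c b i k) = LinearMap.id := by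
    refine linearMap_ext_basisVector b fun i k h0 hk => ?_
    simp only [LinearMap.sum_apply, LinearMap.smulRight_apply, coordAt_basisVector h0 hk,
      LinearMap.id_apply]
    rw [Finset.sum_eq_single i, Finset.sum_eq_single k]
    · simp
    · intro k' _ hk'
      rw [if_neg (by tauto), zero_smul]
    · intro h
      rw [Finset.mem_Icc] at h
      omega
    · intro i' _ hi'
      refine Finset.sum_eq_zero fun k' _ => ?_
      rw [if_neg (by tauto), zero_smul]
    · intro h
      rw [Finset.mem_range, ← c.len_pos_iff] at h
      omega
  simpa using LinearMap.congr_fun this u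

theorem exists_nonpos_color [NeZero n] (m : ZMod n) (c : ColoredPartition n) (i : ℕ) :
    ∃ k : ℤ, k ≤ 0 ∧ c.color i + (((c.len i : ℤ) - k : ℤ) : ZMod n) = m :=
  ⟨_, MarkedColoredPartition.rhoCandidates_nonempty m c.zeroMarking i |>.some_mem⟩

/-- The part of a colored vector in one row is obtained from a single basis vector `v_{i,k}` by an
invertible change of the last vector of the row. -/
theorem IsColoredJordanBasis.exists_row_generator [NeZero n] (hC : DirectSum.IsInternal C)
    {x : Module.End F V} (hb : IsColoredJordanBasis C x c b) {m : ZMod n} {v : V} (hv : v ∈ C m)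
    (i : ℕ) :
    ∃ (k : ℤ) (w : V) (a : F), k ≤ c.len i ∧
      c.color i + (((c.len i : ℤ) - k : ℤ) : ZMod n) = m ∧ w ∈ C (c.color i) ∧
      (x ^ c.len i) w = 0 ∧ a ≠ 0 ∧
      (x ^ (c.len i - 1)) w = a • basisVector c b i 1 ∧
      (x ^ ((c.len i : ℤ) - k).toNat) w =
        ∑ l ∈ Finset.Icc (1 : ℤ) (c.len i), coordAt c b i l v • basisVector c b i l := by
  classical
  let S := (Finset.Icc (1 : ℤ) (c.len i)).filter fun l => coordAt c b i l v ≠ 0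
  have hS0 : ∀ l ∈ Finset.Icc (1 : ℤ) (c.len i), l ∉ S → coordAt c b i l v = 0 := by
    intro l hl hlS
    by_contra h
    exact hlS (Finset.mem_filter.2 ⟨hl, h⟩)
  rcases S.eq_empty_or_nonempty with hS | hS
  -- If `v` has no part in row `i`, the generator is kept and a nonpositive mark of color `m` is
  -- used.
  · obtain ⟨k, hk0, hk⟩ := exists_nonpos_color m c i
    refine ⟨k, basisVector c b i (c.len i), 1, by omega, hk, ?_, ?_, one_ne_zero, ?_, ?_⟩
    · simpa using hb.basisVector_mem i (c.len i)
    · rw [hb.pow_apply_basisVector le_rfl, basisVector_of_nonpos (by omega)]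
    · rw [hb.pow_apply_basisVector le_rfl, one_smul]
      rcases Nat.eq_zero_or_pos (c.len i) with h | h
      · rw [basisVector_of_nonpos (by omega), basisVector, dif_neg (by omega)]
      · congr 1
        omega
    · rw [hb.pow_apply_basisVector le_rfl, basisVector_of_nonpos (by omega)]
      refine (Finset.sum_eq_zero fun l hl => ?_).symm
      rw [hS0 l hl (by simp [hS]), zero_smul]
  · let k := S.max' hS
    have hkS : k ∈ S := S.max'_mem hS
    have hkmax : ∀ l ∈ S, l ≤ k := fun l hl => S.le_max' l hl
    have hkI := Finset.mem_Icc.1 (Finset.mem_filter.1 hkS).1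
    have hk0 := (Finset.mem_filter.1 hkS).2
    have hkm := hb.color_eq_of_coordAt_ne_zero hC hv hk0
    have hpow : ∀ s : ℕ, (x ^ s) (∑ l ∈ S, coordAt c b i l v •
        basisVector c b i (l + (c.len i - k))) =
        ∑ l ∈ S, coordAt c b i l v • basisVector c b i (l + (c.len i - k) - s) := by
      intro s
      rw [map_sum]
      refine Finset.sum_congr rfl fun l hl => ?_
      have := hkmax l hl
      rw [map_smul, hb.pow_apply_basisVector (by omega)]
    -- The row part is shifted right until its last column `k` reaches `λ_i`. All `l ∈ S` are
    -- congruent to `k` modulo `n`, so the result has the color of `v_{i,λ_i}`; its leading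
    -- coefficient is nonzero.
    refine ⟨k, ∑ l ∈ S, coordAt c b i l v • basisVector c b i (l + (c.len i - k)),
      coordAt c b i k v, hkI.2, hkm, ?_, ?_, hk0, ?_, ?_⟩
    · refine Submodule.sum_mem _ fun l hl => Submodule.smul_mem _ _ ?_
      have hlm := hb.color_eq_of_coordAt_ne_zero hC hv (Finset.mem_filter.1 hl).2
      have hkl : (l : ZMod n) = (k : ZMod n) := by
        have := hlm.trans hkm.symm
        push_cast at this
        exact sub_right_inj.1 (add_left_cancel this)
      convert hb.basisVector_mem i (l + (c.len i - k)) using 2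
      push_cast
      rw [hkl]
      ring
    · rw [hpow]
      refine Finset.sum_eq_zero fun l hl => ?_
      have := hkmax l hl
      rw [basisVector_of_nonpos (by omega), smul_zero]
    · rw [hpow, Finset.sum_eq_single k]
      · congr 2
        omega
      · intro l hl hlk
        have := hkmax l hl
        rw [basisVector_of_nonpos (by omega), smul_zero]
      · exact fun h => absurd hkS h
    · rw [hpow]
      refine Finset.sum_subset_zero_on_sdiff (Finset.filter_subset _ _) (fun l hl => ?_)
        fun l _ => ?_
      · rw [hS0 l (Finset.mem_sdiff.1 hl).1 (Finset.mem_sdiff.1 hl).2, zero_smul]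
      · congr 2
        omega

/-- Relative to a given colored Jordan basis of `x`, the orbit of every colored vector contains
a sum `∑ v_{i, μ_i}`. -/
theorem exists_rowSum_of_mem [FiniteDimensional F V] [NeZero n] (hC : DirectSum.IsInternal C)
    {x : NilCone C} (hb : IsColoredJordanBasis C x.1 c b) {m : ZMod n} {v : V} (hv : v ∈ C m) :
    ∃ μ : ℕ → ℤ, (∀ i, μ i ≤ c.len i) ∧
      (∀ i, c.color i + (((c.len i : ℤ) - μ i : ℤ) : ZMod n) = m) ∧
      orbitOf C (rowSum c b μ) x = orbitOf C v x := by
  choose μ w a hμ hcol hw hw0 ha hw1 hwv using hb.exists_row_generator hC hv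
  obtain ⟨T, hTx, hTC, hT⟩ := hb.exists_end hC x.2.2 w hw hw0
  have hT1 : ∀ i, 0 < c.len i → T (basisVector c b i 1) = a i • basisVector c b i 1 := by
    intro i hi
    rw [hT i 1 (by omega), ← hw1]
    congr 2
    omega
  have hinj : Function.Injective T := by
    -- On `ker x`, spanned by the `v_{i,1}`, `T` is diagonal with nonzero entries `a i`.
    refine injective_of_injective_on_ker x.2.1 hTx fun u hu hTu => ?_
    have h2 : ∀ i (k : ℤ), 1 < k → coordAt c b i k u = 0 := by
      intro i k hk
      have := hb.coordAt_apply (i := i) (k := k - 1) (by omega) u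
      rwa [hu, map_zero, sub_add_cancel, eq_comm] at this
    have h3 : u = ∑ i ∈ Finset.range c.length, coordAt c b i 1 u • basisVector c b i 1 := by
      conv_lhs => rw [← sum_coordAt_smul b u]
      refine Finset.sum_congr rfl fun i hi => ?_
      rw [Finset.mem_range, ← c.len_pos_iff] at hi
      refine Finset.sum_eq_single 1 (fun k hk hk1 => ?_) fun h => ?_
      · rw [Finset.mem_Icc] at hk
        rw [h2 i k (by omega), zero_smul]
      · rw [Finset.mem_Icc] at h
        omega
    refine eq_zero_of_coordAt (b := b) fun i k h0 hk => ?_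
    by_cases hk1 : 1 < k
    · exact h2 i k hk1
    obtain rfl : k = 1 := by omega
    have h4 : coordAt c b i 1 (T u) = a i * coordAt c b i 1 u := by
      conv_lhs => rw [h3]
      rw [map_sum, map_sum, Finset.sum_eq_single i]
      · rw [map_smul, map_smul, hT1 i (by omega), map_smul, coordAt_basisVector h0 hk,
          if_pos ⟨rfl, rfl⟩]
        simp [mul_comm]
      · intro j hj hji
        rw [Finset.mem_range, ← c.len_pos_iff] at hj
        rw [map_smul, map_smul, hT1 j hj, map_smul, coordAt_basisVector one_pos (by omega),
          if_neg (by tauto)]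
        simp
      · intro h
        rw [Finset.mem_range, ← c.len_pos_iff] at h
        omega
    rw [hTu, map_zero] at h4
    exact (mul_eq_zero.1 h4.symm).resolve_left (ha i)
  refine ⟨μ, hμ, hcol, ?_⟩
  rw [← orbitOf_apply_eq hinj hTx hTC (rowSum c b μ)]
  congr 1
  rw [rowSum, map_sum, ← sum_coordAt_smul b v]
  refine Finset.sum_congr rfl fun i _ => ?_
  rw [hT i _ (hμ i), hwv]

end ColoredVector

/-! ### Existence of colored Jordan bases -/

section Existence

variable {F : Type*} [Field F] {V : Type*} [AddCommGroup V] [Module F V] {n : ℕ}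
  {C : ZMod n → Submodule F V} {x : Module.End F V}

theorem sum_filter_color_eq_zero (hC : DirectSum.IsInternal C) {ι : Type*}
    {s : Finset ι} {f : ι → V} {κ : ι → ZMod n} (hf : ∀ i ∈ s, f i ∈ C (κ i))
    (h : ∑ i ∈ s, f i = 0) (a : ZMod n) : ∑ i ∈ s with κ i = a, f i = 0 := by
  rw [← Finset.sum_filter_add_sum_filter_not s (fun i => κ i = a)] at h
  refine Submodule.disjoint_def.1 (hC.submodule_iSupIndep a) _
    (Submodule.sum_mem _ fun i hi => ?_) ?_
  · rw [Finset.mem_filter] at hi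
    exact hi.2 ▸ hf i hi.1
  · rw [eq_neg_of_add_eq_zero_left h]
    refine Submodule.neg_mem _ (Submodule.sum_mem _ fun i hi => ?_)
    rw [Finset.mem_filter] at hi
    exact (le_iSup₂_of_le (f := fun k (_ : k ≠ a) => C k) _ hi.2 le_rfl) (hf i hi.1)

/-- A family of colored vectors that generates `V` under `x`, where `x ^ l i` kills the `i`-th
vector. -/
structure IsColoredGenerators (C : ZMod n → Submodule F V) (x : Module.End F V) {N : ℕ}
    (g : Fin N → V) (κ : Fin N → ZMod n) (l : Fin N → ℕ) : Prop where
  mem_color : ∀ i, g i ∈ C (κ i)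
  pow_apply : ∀ i, (x ^ l i) (g i) = 0
  span_eq_top : Submodule.span F (Set.range fun p : Fin N × ℕ => (x ^ p.2) (g p.1)) = ⊤

theorem exists_isColoredGenerators [FiniteDimensional F V] [NeZero n]
    (hC : DirectSum.IsInternal C) (hx : IsNilpotent x) :
    ∃ (N : ℕ) (g : Fin N → V) (κ : Fin N → ZMod n) (l : Fin N → ℕ),
      IsColoredGenerators C x g κ l := by
  classical
  obtain ⟨k, hk⟩ := hx
  let B := hC.collectedBasis fun m => Module.finBasis F (C m)
  let e := Fintype.equivFin (Σ m, Fin (Module.finrank F (C m)))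
  refine ⟨_, fun i => B (e.symm i), fun i => (e.symm i).1, fun _ => k, fun i => ?_, fun i => ?_, ?_⟩
  · exact hC.collectedBasis_mem (fun m => Module.finBasis F (C m)) (e.symm i)
  · rw [hk, LinearMap.zero_apply]
  · rw [eq_top_iff, ← B.span_eq, Submodule.span_le]
    rintro _ ⟨p, rfl⟩
    exact Submodule.subset_span ⟨(e p, 0), by simp⟩

theorem IsColoredGenerators.pow_apply_of_le {N : ℕ} {g : Fin N → V} {κ : Fin N → ZMod n}
    {l : Fin N → ℕ} (hg : IsColoredGenerators C x g κ l) {i : Fin N} {j : ℕ} (h : l i ≤ j) :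
    (x ^ j) (g i) = 0 := by
  obtain ⟨t, rfl⟩ := Nat.exists_eq_add_of_le h
  rw [add_comm, pow_add, Module.End.mul_apply, hg.pow_apply, map_zero]

/-- A linear relation between the vectors `x ^ j (g i)`, `j < l i`, allows to shorten one of the
rows. -/
theorem IsColoredGenerators.exists_shorter (hC : DirectSum.IsInternal C)
    (hx : ∀ i, ∀ v ∈ C i, x v ∈ C (i + 1)) {N : ℕ} {g : Fin N → V} {κ : Fin N → ZMod n}
    {l : Fin N → ℕ} (hg : IsColoredGenerators C x g κ l)
    (hli : ¬ LinearIndependent F fun p : Σ i, Fin (l i) => (x ^ (p.2 : ℕ)) (g p.1)) :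
    ∃ (g' : Fin N → V) (l' : Fin N → ℕ), IsColoredGenerators C x g' κ l' ∧
      ∑ i, l' i < ∑ i, l i := by
  classical
  obtain ⟨a, ha, p₀, hp₀⟩ := Fintype.not_linearIndependent_iff.1 hli
  -- Among the terms of the relation, take one with the most powers of `x` left before it dies.
  -- Applying `x ^ D` with `D` one less than that number leaves only terms `x ^ (l i - 1) (g i)`,
  -- and the component of one color is kept.
  obtain ⟨p₁, hp₁, hmax⟩ := Finset.exists_max_image
    (Finset.univ.filter fun p : Σ i, Fin (l i) => a p ≠ 0) (fun p => l p.1 - p.2)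
    ⟨p₀, by simpa using hp₀⟩
  simp only [Finset.mem_filter, Finset.mem_univ, true_and] at hp₁ hmax
  obtain ⟨D, hD⟩ : ∃ D, l p₁.1 = p₁.2 + (D + 1) := ⟨l p₁.1 - p₁.2 - 1, by omega⟩
  let colorOf : (Σ i, Fin (l i)) → ZMod n := fun p => κ p.1 + ((D + p.2 : ℕ) : ZMod n)
  let S := Finset.univ.filter fun p : Σ i, Fin (l i) =>
    colorOf p = colorOf p₁ ∧ a p ≠ 0 ∧ l p.1 = p.2 + (D + 1)
  have hS : ∀ p, p ∈ S ↔ colorOf p = colorOf p₁ ∧ a p ≠ 0 ∧ l p.1 = p.2 + (D + 1) := by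
    simp [S]
  have hsum : ∑ p ∈ S, a p • (x ^ (l p.1 - 1)) (g p.1) = 0 := by
    have h1 : ∑ p : Σ i, Fin (l i), a p • (x ^ (D + p.2)) (g p.1) = 0 := by
      have := congrArg (x ^ D) ha
      simpa only [map_sum, map_smul, map_zero, pow_add, Module.End.mul_apply] using this
    have h2 := sum_filter_color_eq_zero hC (κ := colorOf) (fun p _ => Submodule.smul_mem _ (a p)
      (pow_apply_mem hx (hg.mem_color p.1) (D + p.2))) h1 (colorOf p₁)
    rw [← h2]
    refine Finset.sum_subset_zero_on_sdiff (fun p hp => ?_) (fun p hp => ?_) fun p hp => ?_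
    · simpa using ((hS p).1 hp).1
    · rw [Finset.mem_sdiff, hS, Finset.mem_filter] at hp
      by_cases hap : a p = 0
      · rw [hap, zero_smul]
      · have h3 := hmax p hap
        have h4 : l p.1 ≠ p.2 + (D + 1) := fun h => hp.2 ⟨hp.1.2, hap, h⟩
        rw [hg.pow_apply_of_le (by omega), smul_zero]
    · have h3 := ((hS p).1 hp).2.2
      congr 3
      omega
  -- For the shortest row `q` occurring, `x ^ (l q - 1)` factors out of the relation. The cofactor
  -- `u` has the color of `g q` and is killed by `x ^ (l q - 1)`, so it can replace `g q`.
  obtain ⟨q, hq, hmin⟩ := Finset.exists_min_image S (fun p => l p.1)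
    ⟨p₁, (hS p₁).2 ⟨rfl, hp₁, hD⟩⟩
  obtain ⟨hqc, hqa, hql⟩ := (hS q).1 hq
  let u : V := ∑ p ∈ S, a p • (x ^ (l p.1 - l q.1)) (g p.1)
  have hu : u = a q • g q.1 + ∑ p ∈ S.erase q, a p • (x ^ (l p.1 - l q.1)) (g p.1) := by
    simp only [u]
    rw [← Finset.add_sum_erase _ _ hq, Nat.sub_self, pow_zero, Module.End.one_apply]
  -- Each row contributes at most one term to `S`, its position being fixed by `D`; so `g q` can be
  -- recovered from `u` and the other rows.
  have hne : ∀ p ∈ S.erase q, p.1 ≠ q.1 := by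
    rintro ⟨i, j⟩ hp h
    rw [Finset.mem_erase, hS] at hp
    obtain ⟨i', j'⟩ := q
    simp only at h
    subst h
    refine hp.1 ?_
    have h1 := hp.2.2.2
    simp only at h1 hql
    congr 1
    exact Fin.ext (by omega)
  refine ⟨Function.update g q.1 u, Function.update l q.1 (l q.1 - 1),
    ⟨fun i => ?_, fun i => ?_, ?_⟩, ?_⟩
  · by_cases hi : i = q.1
    · subst hi
      rw [Function.update_self]
      refine Submodule.sum_mem _ fun p hp => Submodule.smul_mem _ _ ?_
      have h1 := pow_apply_mem hx (hg.mem_color p.1) (l p.1 - l q.1)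
      have h2 := hmin p hp
      obtain ⟨hpc, -, hpl⟩ := (hS p).1 hp
      have h3 : l p.1 - l q.1 = (p.2 : ℕ) - q.2 := by omega
      convert h1 using 2
      rw [h3]
      have h4 := hpc.trans hqc.symm
      simp only [colorOf] at h4
      rw [Nat.cast_sub (by omega)]
      push_cast at h4
      linear_combination -h4
    · rw [Function.update_of_ne hi]
      exact hg.mem_color i
  · by_cases hi : i = q.1
    · subst hi
      rw [Function.update_self, Function.update_self, ← hsum, map_sum]
      refine Finset.sum_congr rfl fun p hp => ?_
      have h2 := hmin p hp
      rw [map_smul, ← Module.End.mul_apply, ← pow_add]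
      congr 3
      omega
    · rw [Function.update_of_ne hi, Function.update_of_ne hi]
      exact hg.pow_apply i
  · rw [eq_top_iff, ← hg.span_eq_top, Submodule.span_le]
    have hmem : ∀ i j, i ≠ q.1 → (x ^ j) (g i) ∈ Submodule.span F
        (Set.range fun p : Fin N × ℕ => (x ^ p.2) (Function.update g q.1 u p.1)) :=
      fun i j hi => Submodule.subset_span ⟨(i, j), by simp [Function.update_of_ne hi]⟩
    rintro _ ⟨⟨i, j⟩, rfl⟩
    by_cases hi : i = q.1
    · subst hi
      have h1 : (x ^ j) (g q.1) = (a q)⁻¹ • ((x ^ j) u -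
          ∑ p ∈ S.erase q, a p • (x ^ (j + (l p.1 - l q.1))) (g p.1)) := by
        rw [hu, map_add, map_sum, map_smul]
        simp only [map_smul, pow_add, Module.End.mul_apply, add_sub_cancel_right]
        rw [smul_smul, inv_mul_cancel₀ hqa, one_smul]
      simp only [SetLike.mem_coe]
      rw [h1]
      refine Submodule.smul_mem _ _ (Submodule.sub_mem _ ?_ (Submodule.sum_mem _ fun p hp =>
        Submodule.smul_mem _ _ (hmem _ _ (hne p hp))))
      exact Submodule.subset_span ⟨(q.1, j), by simp⟩
    · exact hmem i j hi
  · refine Finset.sum_lt_sum (fun i _ => ?_) ⟨q.1, Finset.mem_univ _, ?_⟩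
    · by_cases hi : i = q.1
      · rw [hi, Function.update_self]
        omega
      · rw [Function.update_of_ne hi]
    · rw [Function.update_self]
      omega

theorem exists_linearIndependent_generators [FiniteDimensional F V] [NeZero n]
    (hC : DirectSum.IsInternal C) (hnil : IsNilpotent x)
    (hx : ∀ i, ∀ v ∈ C i, x v ∈ C (i + 1)) :
    ∃ (N : ℕ) (g : Fin N → V) (κ : Fin N → ZMod n) (l : Fin N → ℕ),
      IsColoredGenerators C x g κ l ∧
      LinearIndependent F fun p : Σ i, Fin (l i) => (x ^ (p.2 : ℕ)) (g p.1) := by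
  obtain ⟨N, g, κ, l, hg⟩ := exists_isColoredGenerators hC hnil
  obtain ⟨T, hT⟩ : ∃ T, ∑ i, l i = T := ⟨_, rfl⟩
  induction T using Nat.strong_induction_on generalizing g l with
  | _ T ih =>
  by_cases hli : LinearIndependent F fun p : Σ i, Fin (l i) => (x ^ (p.2 : ℕ)) (g p.1)
  · exact ⟨N, g, κ, l, hg, hli⟩
  · obtain ⟨g', l', hg', hlt⟩ := hg.exists_shorter hC hx hli
    exact ih _ (hT ▸ hlt) g' l' hg' rfl

/-- Every element of the colored nilpotent cone has a colored Jordan basis. -/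
theorem exists_hasColoredJordanType [FiniteDimensional F V] [NeZero n]
    (hC : DirectSum.IsInternal C) (hnil : IsNilpotent x)
    (hx : ∀ i, ∀ v ∈ C i, x v ∈ C (i + 1)) : ∃ c, HasColoredJordanType C x c := by
  obtain ⟨N, g, κ, l, hg, hli⟩ := exists_linearIndependent_generators hC hnil hx
  let τ : Equiv.Perm (Fin N) := Tuple.sort fun i => OrderDual.toDual (l i)
  have hτ : Monotone ((fun i => OrderDual.toDual (l i)) ∘ τ) := Tuple.monotone_sort _
  let c : ColoredPartition n :=
    { len := fun i => if h : i < N then l (τ ⟨i, h⟩) else 0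
      -- The empty rows are colored cyclically, so that every color occurs infinitely often.
      color := fun i => if h : i < N then κ (τ ⟨i, h⟩) else (i : ZMod n)
      len_antitone := by
        intro i j hij
        by_cases hj : j < N
        · simp only [dif_pos hj, dif_pos (hij.trans_lt hj)]
          exact hτ (show (⟨i, hij.trans_lt hj⟩ : Fin N) ≤ ⟨j, hj⟩ from hij)
        · simp only [dif_neg hj]
          exact Nat.zero_le _
      exists_len_eq_zero := ⟨N, by simp⟩
      infinite_color := by
        intro m
        refine Set.infinite_of_not_bddAbove ?_
        rintro ⟨M, hM⟩
        have hn := NeZero.pos n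
        have hle : N + M + 1 ≤ n * (N + M + 1) := Nat.le_mul_of_pos_left _ hn
        have := hM (show m.val + n * (N + M + 1) ∈ _ by
          simp only [Set.mem_ofPred_eq]
          rw [dif_neg (by omega)]
          simp)
        omega }
  have hN : ∀ i, 0 < c.len i → i < N := by
    intro i hi
    by_contra h
    simp only [c, dif_neg h] at hi
    omega
  have hlen : ∀ i (h : i < N), c.len i = l (τ ⟨i, h⟩) := fun i h => dif_pos h
  have hcolor : ∀ i (h : i < N), c.color i = κ (τ ⟨i, h⟩) := fun i h => dif_pos h
  have hpN : ∀ p : c.Box, p.1 < N := fun p => hN p.1 (Fin.pos p.2)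
  -- Powers of `x` run from the right end of a row, boxes from the left, hence the reversal of the
  -- column.
  let e : c.Box → Σ i, Fin (l i) := fun p =>
    ⟨τ ⟨p.1, hpN p⟩, ⟨c.len p.1 - 1 - p.2, by
      have h1 := hlen p.1 (hpN p)
      have h2 := p.2.2
      omega⟩⟩
  have he : Function.Injective e := by
    rintro ⟨i, j⟩ ⟨i', j'⟩ h
    have h1 : i = i' := by
      have := congrArg Sigma.fst h
      simpa [e] using this
    subst h1
    have h2 : c.len i - 1 - j = c.len i - 1 - (j' : ℕ) := by
      simpa [e] using h
    congr 1
    exact Fin.ext (by omega)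
  have hspan : ⊤ ≤ Submodule.span F (Set.range
      ((fun p : Σ i, Fin (l i) => (x ^ (p.2 : ℕ)) (g p.1)) ∘ e)) := by
    rw [← hg.span_eq_top, Submodule.span_le]
    rintro _ ⟨⟨i, j⟩, rfl⟩
    by_cases hj : j < l i
    · have h1 : (τ ⟨τ.symm i, (τ.symm i).2⟩) = i := by simp
      have h2 : c.len (τ.symm i) = l i := by rw [hlen _ (τ.symm i).2, h1]
      refine Submodule.subset_span ⟨⟨τ.symm i, ⟨l i - 1 - j, by omega⟩⟩, ?_⟩
      have h3 : c.len (τ.symm i) - 1 - (l i - 1 - j) = j := by omega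
      simp only [Function.comp_apply, e, h3, Fin.eta, Equiv.apply_symm_apply]
    · simp only [SetLike.mem_coe]
      rw [hg.pow_apply_of_le (by omega)]
      exact Submodule.zero_mem _
  let b := Module.Basis.mk (hli.comp e he) hspan
  have hb : ∀ i (h : i < N) j (hj : j < c.len i),
      b ⟨i, ⟨j, hj⟩⟩ = (x ^ (c.len i - 1 - j)) (g (τ ⟨i, h⟩)) := fun i h j hj => by
    rw [Module.Basis.mk_apply]
    rfl
  refine ⟨c, b, ⟨?_, fun i h => ?_, fun i j h => ?_⟩⟩
  · rintro ⟨i, j, hj⟩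
    have hi := hN i (by omega)
    rw [hb i hi]
    convert pow_apply_mem hx (hg.mem_color _) (c.len i - 1 - j) using 2
    rw [ColoredPartition.boxColor, hcolor i hi, ← Int.cast_natCast (R := ZMod n)
      (c.len i - 1 - j)]
    congr 2
    simp only
    omega
  · rw [hb i (hN i h), ← Module.End.mul_apply, ← pow_succ']
    refine hg.pow_apply_of_le ?_
    rw [← hlen]
    omega
  · have hi := hN i (by omega)
    rw [hb i hi, hb i hi, ← Module.End.mul_apply, ← pow_succ']
    congr 2
    omega

end Existence

/-! ### Parameters of orbits -/

section Main

variable {F : Type*} [Field F] {V : Type*} [AddCommGroup V] [Module F V] {n : ℕ}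
  {C : ZMod n → Submodule F V}

theorem exists_orbitOf_eq (O : Orbit C) : ∃ v x, orbitOf C v x = O := by
  obtain ⟨⟨v, x⟩, rfl⟩ := Quotient.exists_rep O
  exact ⟨v, x, rfl⟩

variable [FiniteDimensional F V] [NeZero n]

theorem hasNormalBasis_iff (hC : DirectSum.IsInternal C) {v : V} {x : NilCone C} :
    HasNormalBasis C v x ↔ ∃ P : MarkedColoredPartition n,
      P.IsGeneralizedQuasiBipartition ∧ CorrespondsTo C hC P (orbitOf C v x) := by
  constructor
  · rintro ⟨P, b, hb, hv, hP⟩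
    exact ⟨P, hP, (correspondsTo_orbitOf_iff hC).2 ⟨b, hb, hv⟩⟩
  · rintro ⟨P, hP, h⟩
    obtain ⟨b, hb, hv⟩ := (correspondsTo_orbitOf_iff hC).1 h
    exact ⟨P, b, hb, hv, hP⟩

theorem exists_generalized_correspondsTo_psi (hC : DirectSum.IsInternal C)
    (P : MarkedOfSignature (spaceSignature C)) : ∃ Q : MarkedColoredPartition n,
      Q.IsGeneralizedQuasiBipartition ∧ CorrespondsTo C hC Q (psi C hC P) := by
  obtain ⟨-, x, b, hb, -⟩ := exists_psi hC P
  obtain ⟨μ, hμ, hg, -, horb⟩ := exists_generalized hC hb P.1.mark P.1.mark_le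
  refine ⟨_, hg, ?_⟩
  rw [psi_eq hC P hb, markedVector_eq_rowSum, ← horb, correspondsTo_orbitOf_iff]
  exact ⟨b, hb, rfl⟩

/-- Raising preserves mark colors, and here all of them equal `m`; so the generalized inequalities
hold for all pairs of rows. -/
theorem exists_coloredQuasiBipartition (hC : DirectSum.IsInternal C) {m : ZMod n} {v : V}
    (hv : v ∈ C m) (x : NilCone C) : ∃ P : MarkedColoredPartition n,
      P.IsColoredQuasiBipartition ∧ CorrespondsTo C hC P (orbitOf C v x) := by
  obtain ⟨c, b, hb⟩ := exists_hasColoredJordanType hC x.2.1 x.2.2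
  obtain ⟨μ, hμ, hcol, horb⟩ := exists_rowSum_of_mem hC hb hv
  obtain ⟨μ', hμ', hg, hcast, horb'⟩ := exists_generalized hC hb μ hμ
  have hmc : ∀ i, (c.withMark μ' hμ').markColor i = m := by
    intro i
    rw [← hcol i]
    change c.color i + (((c.len i : ℤ) - μ' i : ℤ) : ZMod n) = _
    push_cast
    rw [hcast]
  refine ⟨_, ⟨hg.1, fun i j hij => hg.2 i j hij ((hmc i).trans (hmc j).symm),
    fun i j => (hmc i).trans (hmc j).symm⟩, ?_⟩
  rw [← horb, ← horb', correspondsTo_orbitOf_iff]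
  exact ⟨b, hb, rfl⟩

theorem mem_enhancedOrbits_iff (hC : DirectSum.IsInternal C) (O : Orbit C) :
    O ∈ enhancedOrbits C ↔
      ∃ P : MarkedColoredPartition n, P.IsColoredQuasiBipartition ∧ CorrespondsTo C hC P O := by
  constructor
  · rintro ⟨v, hv, x, rfl⟩
    obtain ⟨m, hm⟩ := Set.mem_iUnion.1 hv
    exact exists_coloredQuasiBipartition hC hm x
  · rintro ⟨P, hP, h⟩
    obtain ⟨v, x, rfl⟩ := exists_orbitOf_eq O
    obtain ⟨b, hb, rfl⟩ := (correspondsTo_orbitOf_iff hC).1 h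
    exact ⟨_, Set.mem_iUnion.2 ⟨P.markColor 0, markedVector_mem hb fun i _ => hP.2.2 i 0⟩, x, rfl⟩

theorem rowEquiv_of_correspondsTo (hC : DirectSum.IsInternal C) {v : V} (hv : v ≠ 0)
    {x : NilCone C} {P Q : MarkedColoredPartition n} (hP : P.IsColoredQuasiBipartition)
    (hPO : CorrespondsTo C hC P (orbitOf C v x)) (hQ : Q.IsColoredQuasiBipartition)
    (hQO : CorrespondsTo C hC Q (orbitOf C v x)) : P.RowEquiv Q := by
  obtain ⟨b, hb, rfl⟩ := (correspondsTo_orbitOf_iff hC).1 hPO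
  obtain ⟨d, hd, h⟩ := (correspondsTo_orbitOf_iff hC).1 hQO
  exact rowEquiv_of_markedVector_eq hC x.2.2 hb hd hP hQ h hv

theorem correspondsTo_zero_iff (hC : DirectSum.IsInternal C) {x : NilCone C}
    {P : MarkedColoredPartition n} : CorrespondsTo C hC P (orbitOf C 0 x) ↔
      HasColoredJordanType C x.1 P.toColoredPartition ∧ ∀ i, P.mark i ≤ 0 := by
  rw [correspondsTo_orbitOf_iff]
  constructor
  · rintro ⟨b, hb, h⟩
    exact ⟨⟨b, hb⟩, markedVector_eq_zero_iff.1 h.symm⟩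
  · rintro ⟨⟨b, hb⟩, h⟩
    exact ⟨b, hb, (markedVector_eq_zero_iff.2 h).symm⟩

/-- Injectivity of `Ψ` on the classes. At `v = 0` row equivalence can fail, but all marks are
nonpositive and only the Jordan type counts. -/
theorem weakEquiv_of_correspondsTo (hC : DirectSum.IsInternal C) {O : Orbit C}
    {P Q : MarkedColoredPartition n} (hP : P.IsColoredQuasiBipartition)
    (hPO : CorrespondsTo C hC P O) (hQ : Q.IsColoredQuasiBipartition)
    (hQO : CorrespondsTo C hC Q O) : P.WeakEquiv Q := by
  obtain ⟨v, x, rfl⟩ := exists_orbitOf_eq O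
  by_cases hv : v = 0
  · subst hv
    obtain ⟨hP1, hP2⟩ := (correspondsTo_zero_iff hC).1 hPO
    obtain ⟨hQ1, hQ2⟩ := (correspondsTo_zero_iff hC).1 hQO
    obtain ⟨σ, hσ⟩ := hP1.exists_permutedBy hC hQ1
    refine ⟨σ, fun i => ⟨(hσ i).1, (hσ i).2, fun h => ?_⟩⟩
    have := hP2 (σ i)
    have := hQ2 i
    omega
  · exact (rowEquiv_of_correspondsTo hC hv hP hPO hQ hQO).weakEquiv

theorem exists_eq_rho_of_correspondsTo_zero (hC : DirectSum.IsInternal C) {x : NilCone C}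
    {P : MarkedColoredPartition n} (hP : P.IsColoredQuasiBipartition)
    (hPO : CorrespondsTo C hC P (orbitOf C 0 x)) :
    ∃ m, P = P.toColoredPartition.zeroMarking.rho m := by
  refine ⟨P.markColor 0, ?_⟩
  have h := (correspondsTo_zero_iff hC).1 hPO
  refine MarkedColoredPartition.ext rfl rfl (funext fun i => ?_)
  exact MarkedColoredPartition.rho_zeroMarking_mark_eq rfl rfl (h.2 i) (hP.1 i) (hP.2.2 i 0)

theorem correspondsTo_rho_zeroMarking (hC : DirectSum.IsInternal C) {x : NilCone C}
    {c : ColoredPartition n} (hc : HasColoredJordanType C x.1 c) (m : ZMod n) :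
    CorrespondsTo C hC (c.zeroMarking.rho m) (orbitOf C 0 x) :=
  (correspondsTo_zero_iff hC).2
    ⟨hc, fun i => MarkedColoredPartition.rho_mark_le m c.zeroMarking i⟩

theorem exists_rowEquiv_rho_iff (hC : DirectSum.IsInternal C) {x : NilCone C}
    {c : ColoredPartition n} (hc : HasColoredJordanType C x.1 c) (P : MarkedColoredPartition n) :
    (P.IsColoredQuasiBipartition ∧ CorrespondsTo C hC P (orbitOf C 0 x)) ↔
      ∃ m : ZMod n, P.RowEquiv (c.zeroMarking.rho m) := by
  constructor
  · rintro ⟨hP, hPO⟩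
    obtain ⟨h1, h2⟩ := (correspondsTo_zero_iff hC).1 hPO
    obtain ⟨σ, hσ⟩ := h1.exists_permutedBy hC hc
    refine ⟨P.markColor 0, σ, fun i => ⟨(hσ i).1, (hσ i).2, Eq.symm ?_⟩⟩
    exact MarkedColoredPartition.rho_zeroMarking_mark_eq (hσ i).1.symm (hσ i).2.symm (h2 _)
      (hP.1 _) (hP.2.2 _ 0)
  · rintro ⟨m, σ, hσ⟩
    have hσ' : ∀ j, P.len j = c.len (σ.symm j) ∧ P.color j = c.color (σ.symm j) ∧
        P.mark j = (c.zeroMarking.rho m).mark (σ.symm j) := by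
      intro j
      have := hσ (σ.symm j)
      rw [Equiv.apply_symm_apply] at this
      exact ⟨this.1.symm, this.2.1.symm, this.2.2.symm⟩
    have h0 : ∀ j, P.mark j ≤ 0 := fun j =>
      (hσ' j).2.2 ▸ MarkedColoredPartition.rho_mark_le m c.zeroMarking _
    refine ⟨MarkedColoredPartition.isColoredQuasiBipartition_of_nonpos (m := m) h0
      (fun j => ?_) (fun j => ?_), (correspondsTo_zero_iff hC).2 ⟨?_, h0⟩⟩
    · rw [(hσ' j).2.2]
      exact (MarkedColoredPartition.rho_zeroMarking_isColoredQuasiBipartition m c).1 _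
    · rw [← MarkedColoredPartition.rho_markColor m c.zeroMarking (σ.symm j)]
      simp only [MarkedColoredPartition.markColor, MarkedColoredPartition.nu, (hσ' j).1,
        (hσ' j).2.1, (hσ' j).2.2]
      rfl
    · exact hc.of_permutedBy (σ := σ.symm) fun j => ⟨(hσ' j).1, (hσ' j).2.1⟩

end Main

end EnhancedCone

theorem mainTheorem1 {F : Type*} [Field F] {V : Type*} [AddCommGroup V] [Module F V]
    [FiniteDimensional F V] {n : ℕ} [NeZero n] (C : ZMod n → Submodule F V)
    (hC : DirectSum.IsInternal C) :
    -- the image of `Ψ`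
    (Set.range (psiClass C hC) =
        {O | ∀ (v : V) (x : NilCone C), orbitOf C v x = O → HasNormalBasis C v x}) ∧
    -- every nonempty fiber of `Ψ` contains a generalized quasi-bipartition
    (∀ q : MarkedClass (spaceSignature C), ∃ P : MarkedColoredPartition n,
        P.IsGeneralizedQuasiBipartition ∧ CorrespondsTo C hC P (psiClass C hC q)) ∧
    -- the bijection
    Set.BijOn (psiClass C hC) (quasiBipartitionClasses (spaceSignature C)) (enhancedOrbits C) ∧
    -- the orbits of colored pairs are those coming from colored quasi-bipartitions
    (∀ O : Orbit C, O ∈ enhancedOrbits C ↔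
        ∃ P : MarkedColoredPartition n, P.IsColoredQuasiBipartition ∧ CorrespondsTo C hC P O) ∧
    -- uniqueness of the parameter for `v ≠ 0`
    (∀ v ∈ coloredVectors C, v ≠ 0 → ∀ (x : NilCone C) (P Q : MarkedColoredPartition n),
        P.IsColoredQuasiBipartition → CorrespondsTo C hC P (orbitOf C v x) →
        Q.IsColoredQuasiBipartition → CorrespondsTo C hC Q (orbitOf C v x) → P.RowEquiv Q) ∧
    -- the parameters for `v = 0`
    (∀ (x : NilCone C) (P : MarkedColoredPartition n),
        (P.IsColoredQuasiBipartition ∧ CorrespondsTo C hC P (orbitOf C 0 x)) ↔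
          ∃ (c : ColoredPartition n) (m : ZMod n),
            HasColoredJordanType C x.1 c ∧ P = c.zeroMarking.rho m) ∧
    (∀ (x : NilCone C) (c : ColoredPartition n), HasColoredJordanType C x.1 c →
        ∀ P : MarkedColoredPartition n,
          (P.IsColoredQuasiBipartition ∧ CorrespondsTo C hC P (orbitOf C 0 x)) ↔
            ∃ m : ZMod n, P.RowEquiv (c.zeroMarking.rho m)) := by
  refine ⟨?_, ?_, ⟨?_, ?_, ?_⟩, mem_enhancedOrbits_iff hC, ?_, ?_, ?_⟩
  · ext O
    constructor
    · rintro ⟨q, rfl⟩ v x hvx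
      obtain ⟨P, rfl⟩ := Quotient.exists_rep q
      rw [hasNormalBasis_iff hC, hvx]
      exact exists_generalized_correspondsTo_psi hC P
    · intro h
      obtain ⟨v, x, rfl⟩ := exists_orbitOf_eq O
      obtain ⟨P, -, hP, hO⟩ := (hasNormalBasis_iff hC).1 (h v x rfl)
      exact ⟨⟦⟨P, hP⟩⟧, hO⟩
  · intro q
    obtain ⟨P, rfl⟩ := Quotient.exists_rep q
    exact exists_generalized_correspondsTo_psi hC P
  · rintro _ ⟨P, hP, rfl⟩
    exact (mem_enhancedOrbits_iff hC _).2 ⟨P.1, hP, P.2, rfl⟩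
  · rintro _ ⟨P, hP, rfl⟩ _ ⟨Q, hQ, rfl⟩ h
    exact Quotient.sound (weakEquiv_of_correspondsTo hC hP ⟨P.2, rfl⟩ hQ ⟨Q.2, h.symm⟩)
  · intro O hO
    obtain ⟨P, hP, hsig, rfl⟩ := (mem_enhancedOrbits_iff hC O).1 hO
    exact ⟨⟦⟨P, hsig⟩⟧, ⟨⟨P, hsig⟩, hP, rfl⟩, rfl⟩
  · intro v _ hv x P Q hP hPO hQ hQO
    exact rowEquiv_of_correspondsTo hC hv hP hPO hQ hQO
  · intro x P
    constructor
    · rintro ⟨hP, hPO⟩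
      obtain ⟨m, hm⟩ := exists_eq_rho_of_correspondsTo_zero hC hP hPO
      exact ⟨_, m, ((correspondsTo_zero_iff hC).1 hPO).1, hm⟩
    · rintro ⟨c, m, hc, rfl⟩
      exact ⟨MarkedColoredPartition.rho_zeroMarking_isColoredQuasiBipartition m c,
        correspondsTo_rho_zeroMarking hC hc m⟩
  · exact fun x c hc P => exists_rowEquiv_rho_iff hC hc P
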